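/- \textbf{Notation.} Let $\omega=\frac{-1+\sqrt3\,i}{2}$ and $\mathbb R^3_0=\{x\in\mathbb R^3: x_1+x_2+x_3=0\}$, and identify $\mathbb R^3_0$ with $\mathbb C$ by the linear similarity sending $(-1,0,1)\mapsto 1$ and $(0,-1,1)\mapsto 1+\omega$. A lattice in $\mathbb R^3_0$ has \emph{shape} $[z]\in \mathrm{SL}_2(\mathbb Z)\backslash\mathbb H$, $z\in\mathbb H$, if under this identification it equals $c(\mathbb Z+\mathbb Z z)$ for some $c\in\mathbb C\setminus\{0\}$; the class $[z]$ is determined by the lattice. Let $\theta$ generate a totally real cubic field whose real embeddings, numbered $\sigma_1,\sigma_2,\sigma_3$, satisfy $|\sigma_1(\theta)|<|\sigma_2(\theta)|<|\sigma_3(\theta)|$. The \emph{unit lattice} of $\mathbb Z[\theta]$ is $$\psi(\mathbb Z[\theta]^\times)\subset\mathbb R^3_0,\qquad \psi(u)=(\log|\sigma_1(u)|,\log|\sigma_2(u)|,\log|\sigma_3(u)|).$$ (An odd renumbering of the embeddings, or the opposite orientation of $\mathbb R^3_0$, would replace each shape $[z]$ by $[-\bar z]$.) \textbf{Assumption.}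 Let $t$ be an integer parameter with $t\to\infty$ or $|t|\to\infty$ (more generally, let $t$ run along any proper filter on $\mathbb Z$ along which $|t|\to\infty$; all conditions on individual $t$ below are only needed eventually). Let $a_t,b_t$ be integers with $a_t^3\equiv 1 \pmod{b_t}$, $b_t^3\equiv 1\pmod{a_t}$ and $|b_t|>|a_t|>0$ such that the limits $$\tilde a=\lim\frac{\log|a_t|}{\log|t|},\qquad \tilde b=\lim\frac{\log|b_t|}{\log|t|}$$ exist and satisfy $\tilde a<\frac13$, $\tilde b<1$. Let $\theta_t\in\mathbb C$ be any root of $$h_t(x)=x^3+\Big(\frac{(a_t^3-1)^2-b_t^3}{a_tb_t^2}+t a_t\Big)x^2+\Big(-a_t\,\frac{a_t^3-1}{b_t}-t b_t\Big)x+1 .$$ \textbf{Theorem.} Under this assumption, eventually $\mathbb Q(\theta_t)$ is a totally real cubic field, the conjugates of $\theta_t$ have distinct absolute values, and the unit lattice $\psi(\mathbb Z[\theta_t]^\times)$ has a shape $[z_t]\in \mathrm{SL}_2(\mathbb Z)\backslash\mathbb H$. These shapes converge in $\mathrm{SL}_2(\mathbb Z)\backslash\mathbb H$ to $[z]$, where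 $$z=z(\tilde a,\tilde b)=\frac{1+2\tilde a+(1+\tilde b+2\tilde a)\omega}{1+\tilde a+(\tilde a-\tilde b)\omega}\in\mathbb H .$$ Moreover: \begin{itemize} \item if $\tilde a=\tilde b=0$, then $z=1+\omega$, so that $\mathbb Z+\mathbb Zz=\mathbb Z+\mathbb Z\omega$ is the regular triangular lattice; \item if $\tilde a=0$, then $|z|=1$; \item if $\tilde a=\tilde b$, then $\operatorname{Re} z=\frac12$; \item if $0<\tilde a<\tilde b<\frac1{10}$, then $z$ lies in the interior of the standard fundamental domain $\{z\in\mathbb H: |z|\ge1,\ |\operatorname{Re}z|\le\frac12\}$ of $\mathrm{SL}_2(\mathbb Z)$. \end{itemize} -/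

import Mathlib

open Filter Topology
open scoped MatrixGroups

namespace UnitShape

noncomputable section

/-- The modular surface `SL₂(ℤ) \ ℍ`, with the quotient topology. -/
abbrev ModularSurface : Type :=
  Quotient (MulAction.orbitRel SL(2, ℤ) UpperHalfPlane)

/-- The class `[z]` of a point of the upper half plane in the modular surface. -/
abbrev cls (z : UpperHalfPlane) : ModularSurface :=
  Quotient.mk (MulAction.orbitRel SL(2, ℤ) UpperHalfPlane) z

/-- The primitive third root of unity `ω = (-1 + √3 i) / 2`. -/
def omega : ℂ := (-1 + (Real.sqrt 3 : ℂ) * Complex.I) / 2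

/-- The linear map to `ℂ` which on the plane `x₀ + x₁ + x₂ = 0` is the similarity sending
`(-1, 0, 1)` to `1` and `(0, -1, 1)` to `1 + ω`. -/
def planeMap : EuclideanSpace ℝ (Fin 3) →ₗ[ℝ] ℂ where
  toFun x := -(x 0 : ℂ) - (x 1 : ℂ) * (1 + omega)
  map_add' x y := by simp; ring
  map_smul' r x := by simp; ring

theorem planeMap_first : planeMap !₂[-1, 0, 1] = 1 := by
  simp [planeMap]

theorem planeMap_second : planeMap !₂[0, -1, 1] = 1 + omega := by
  simp [planeMap]

/-- On the plane of trace zero vectors `planeMap` is a similarity with ratio `1 / √2`. -/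
theorem planeMap_norm_sq (x : EuclideanSpace ℝ (Fin 3)) (hx : ∑ i, x i = 0) :
    ‖planeMap x‖ ^ 2 = ‖x‖ ^ 2 / 2 := by
  have h3 : Real.sqrt 3 * Real.sqrt 3 = 3 := Real.mul_self_sqrt (by norm_num)
  rw [EuclideanSpace.norm_sq_eq, Fin.sum_univ_three, ← Complex.normSq_eq_norm_sq]
  rw [Fin.sum_univ_three] at hx
  have h2 : x 2 = -(x 0) - x 1 := by linarith
  simp only [Real.norm_eq_abs, sq_abs, h2, planeMap, omega, LinearMap.coe_mk, AddHom.coe_mk,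
    Complex.normSq_apply]
  simp
  ring_nf
  rw [show Real.sqrt 3 ^ 2 = 3 by rw [sq, h3]]
  ring

/-- A subgroup `Λ` of `ℝ³` has shape `s` if it lies in the plane `x₀ + x₁ + x₂ = 0` and, under the
identification of this plane with `ℂ` by `planeMap`, it is `c (ℤ + ℤ z)` for some `c ≠ 0` and some
`z ∈ ℍ` whose class is `s`. -/
def HasShape (Λ : AddSubgroup (EuclideanSpace ℝ (Fin 3))) (s : ModularSurface) : Prop :=
  (∀ x ∈ Λ, ∑ i, x i = 0) ∧
    ∃ (z : UpperHalfPlane) (c : ℂ), c ≠ 0 ∧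
      Λ.map planeMap.toAddMonoidHom = AddSubgroup.closure {c, c * (z : ℂ)} ∧ s = cls z

/-- The shape of a subgroup of `ℝ³` is well defined. -/
theorem HasShape.unique {Λ : AddSubgroup (EuclideanSpace ℝ (Fin 3))} {s s' : ModularSurface}
    (h : HasShape Λ s) (h' : HasShape Λ s') : s = s' := by
  obtain ⟨-, z, c, hc, hz, rfl⟩ := h
  obtain ⟨-, w, d, hd, hw, rfl⟩ := h'
  have hE := hz.symm.trans hw
  have e1 : d ∈ AddSubgroup.closure {c, c * (z : ℂ)} := by
    rw [hE]; exact AddSubgroup.subset_closure (by simp)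
  have e2 : d * (w : ℂ) ∈ AddSubgroup.closure {c, c * (z : ℂ)} := by
    rw [hE]; exact AddSubgroup.subset_closure (by simp)
  have e3 : c ∈ AddSubgroup.closure {d, d * (w : ℂ)} := by
    rw [← hE]; exact AddSubgroup.subset_closure (by simp)
  have e4 : c * (z : ℂ) ∈ AddSubgroup.closure {d, d * (w : ℂ)} := by
    rw [← hE]; exact AddSubgroup.subset_closure (by simp)
  rw [AddSubgroup.mem_closure_pair] at e1 e2 e3 e4
  obtain ⟨p, q, h1⟩ := e1
  obtain ⟨r, k, h2⟩ := e2
  obtain ⟨p', q', h3⟩ := e3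
  obtain ⟨r', k', h4⟩ := e4
  simp only [zsmul_eq_mul] at h1 h2 h3 h4
  have hzim : (z : ℂ).im ≠ 0 := z.im_pos.ne'
  have key : ∀ m n : ℤ, (m : ℂ) + n * (z : ℂ) = 0 → m = 0 ∧ n = 0 := by
    intro m n hmn
    have him := congrArg Complex.im hmn
    have hre := congrArg Complex.re hmn
    simp at him hre
    have hn : n = 0 := by
      rcases him with h | h
      · exact h
      · exact absurd h hzim
    subst hn
    simp at hre
    exact ⟨hre, rfl⟩
  have k1 := key (p' * p + q' * r - 1) (p' * q + q' * k) (by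
    push_cast
    apply mul_left_cancel₀ hc
    linear_combination (p' : ℂ) * h1 + q' * h2 + h3)
  have k2 := key (r' * p + k' * r) (r' * q + k' * k - 1) (by
    push_cast
    apply mul_left_cancel₀ hc
    linear_combination (r' : ℂ) * h1 + k' * h2 + h4)
  have hdet : (k * p - r * q) * (k' * p' - r' * q') = 1 := by
    obtain ⟨a1, a2⟩ := k1
    obtain ⟨a3, a4⟩ := k2
    linear_combination (r' * q + k' * k) * a1 - (r' * p + k' * r) * a2 + a4
  have hmob : (w : ℂ) * (q * (z : ℂ) + p) = k * (z : ℂ) + r := by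
    apply mul_left_cancel₀ hc
    linear_combination (w : ℂ) * h1 - h2
  have hre := congrArg Complex.re hmob
  have him := congrArg Complex.im hmob
  simp at hre him
  have hpos : 0 < (k * p - r * q : ℝ) * z.im := by
    have hzp := z.im_pos
    have hwp := w.im_pos
    have hne : 0 < ((q : ℝ) * z.re + p) ^ 2 + (q * z.im) ^ 2 := by
      by_contra hcon
      have hq : (q : ℝ) * z.im = 0 := by nlinarith [sq_nonneg ((q : ℝ) * z.re + p)]
      have hq0 : q = 0 := by
        rcases mul_eq_zero.mp hq with h | h
        · exact_mod_cast h
        · exact absurd h hzp.ne'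
      have hp : (p : ℝ) = 0 := by
        subst hq0
        simpa using hcon
      have hp0 : p = 0 := by exact_mod_cast hp
      subst hq0
      subst hp0
      simp at h1
      exact hd h1.symm
    have := mul_pos hwp hne
    have e : (k * p - r * q : ℝ) * z.im = w.im * (((q : ℝ) * z.re + p) ^ 2 + (q * z.im) ^ 2) := by
      linear_combination (q * z.im : ℝ) * hre - ((q : ℝ) * z.re + p) * him
    rw [e]
    exact this
  have hd1 : k * p - r * q = 1 := by
    rcases Int.isUnit_iff.mp (IsUnit.of_mul_eq_one _ hdet) with h | h
    · exact h
    · exfalso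
      have : (k * p - r * q : ℝ) = -1 := by exact_mod_cast h
      rw [this] at hpos
      linarith [z.im_pos]
  refine Eq.symm (Quotient.sound (s := MulAction.orbitRel SL(2, ℤ) UpperHalfPlane) ?_)
  let g : SL(2, ℤ) := ⟨!![k, r; q, p], by rw [Matrix.det_fin_two_of]; exact hd1⟩
  refine ⟨g, ?_⟩
  apply UpperHalfPlane.ext
  change ((g • z : UpperHalfPlane) : ℂ) = w
  have hden : (q : ℂ) * z + p ≠ 0 := by
    intro h0
    apply hd
    rw [← h1]
    linear_combination c * h0
  rw [UpperHalfPlane.coe_specialLinearGroup_apply]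
  simp [g]
  rw [div_eq_iff hden]
  exact hmob.symm

/-- The logarithmic embedding `ψ(u) = (log |σ₀ u|, log |σ₁ u|, log |σ₂ u|)` of the units of a
subring `O` of a field `K`, with respect to real embeddings `σ₀, σ₁, σ₂` of `K`. -/
def logEmbedding {K : Type*} [Field K] (O : Subalgebra ℤ K) (σ : Fin 3 → (K →+* ℝ)) :
    Additive (↥O)ˣ →+ EuclideanSpace ℝ (Fin 3) where
  toFun u := WithLp.toLp 2 fun i => Real.log |σ i ((u.toMul : (↥O)ˣ) : ↥O)|
  map_zero' := by ext i; simp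
  map_add' u v := by
    ext i
    have hu : σ i ((u.toMul : (↥O)ˣ) : ↥O) ≠ 0 := by simp
    have hv : σ i ((v.toMul : (↥O)ˣ) : ↥O) ≠ 0 := by simp
    simp [abs_mul, Real.log_mul, hu, hv]

/-- The unit lattice `ψ(O^×)`. -/
def unitLattice {K : Type*} [Field K] (O : Subalgebra ℤ K) (σ : Fin 3 → (K →+* ℝ)) :
    AddSubgroup (EuclideanSpace ℝ (Fin 3)) :=
  (logEmbedding O σ).range

/-- `s` is the shape of the unit lattice of `ℤ[θ]`, for a cubic number `θ` whose field `ℚ(θ)` is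
totally real. The three real embeddings of `ℚ(θ)` are numbered such that
`|σ₀ θ| < |σ₁ θ| < |σ₂ θ|`; an odd renumbering would replace `[z]` by `[-conj z]`. -/
def HasUnitShape (θ : ℂ) (s : ModularSurface) : Prop :=
  ∃ σ : Fin 3 → (IntermediateField.adjoin ℚ {θ} →+* ℝ),
    StrictMono (fun i => |σ i (IntermediateField.AdjoinSimple.gen ℚ θ)|) ∧
      HasShape (unitLattice (Algebra.adjoin ℤ {IntermediateField.AdjoinSimple.gen ℚ θ}) σ) s

/-- `(a, b)` is a mutually cubic root pair: `a³ ≡ 1 mod b` and `b³ ≡ 1 mod a`. -/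
def IsMutuallyCubicRootPair (a b : ℤ) : Prop :=
  a ^ 3 ≡ 1 [ZMOD b] ∧ b ^ 3 ≡ 1 [ZMOD a]

/-- The cubic polynomial `x³ + P x² + Q x + 1` with
`(P, Q) = (((a³ - 1)² - b³) / (a b²), -a (a³ - 1) / b) + t (a, -b)`. -/
def cubicPoly (a b t : ℤ) : Polynomial ℚ :=
  Polynomial.X ^ 3
    + Polynomial.C ((((a : ℚ) ^ 3 - 1) ^ 2 - (b : ℚ) ^ 3) / (a * (b : ℚ) ^ 2) + t * a)
      * Polynomial.X ^ 2
    + Polynomial.C (-(a : ℚ) * (((a : ℚ) ^ 3 - 1) / b) + t * (-b)) * Polynomial.X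
    + 1

/-- `z(x, y) = (1 + 2x + (1 + y + 2x) ω) / (1 + x + (x - y) ω)`. -/
def limitPoint (x y : ℝ) : ℂ :=
  (1 + 2 * x + (1 + y + 2 * x) * omega) / (1 + x + (x - y) * omega)

end

end UnitShape

namespace UnitShape

/-! The coefficients `(P, Q)` are integers for which the form `X³ + P X² Y + Q X Y² + Y³` takes the
value `1` at `(b, a)`; the shift `t (a, -b)` does not change this value. Hence both `θ` and `a θ -
b` are units of `ℤ[θ]`.

For large `t` the roots have sizes about `1 / |t b|`, `|b / a|` and `|t a|` (`exists_isRootTriple`).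
Divided by `log |t|`, the log vectors of `θ` and `a θ - b` therefore converge to `(-(1 + β), β - α,
1 + α)` and `(β, -(1 + β + 2α), 1 + 2α)`, and the quotient of their images in `ℂ` converges to
`limitPoint α β`.

It remains to see that these two units generate all units up to sign (`unitLattice_eq_closure`).
Reduce the log vector of a unit modulo the sublattice. The reduced unit `u` has norm `±1` and
conjugates whose ratios are at most some `M`, so the square root of its discriminant is at most `8
M`. That square root is an integer multiple of the one for `ℤ[θ]`, which is at least `t² |a b| /
64`. The exponents satisfy `log M / log |t| < 2 + α + β` in the limit (`exponent_spread_lt`), so the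
multiple is zero, `u` is rational, and `u = ±1`. -/

/-! ### Integrality of the coefficients. -/

theorem IsMutuallyCubicRootPair.exists_quotients {a b : ℤ} (h : IsMutuallyCubicRootPair a b) :
    ∃ k j : ℤ, a ^ 3 - 1 = b * k ∧ k ^ 2 - b = a * j := by
  obtain ⟨k, hk⟩ := Int.modEq_iff_dvd.mp h.1.symm
  obtain ⟨m, hm⟩ := Int.modEq_iff_dvd.mp h.2.symm
  -- `b² (k² - b) = (a³ - 1)² - b³` is divisible by `a`, and `b` is invertible modulo `a` because
  -- `a³ - 1 = b k`.
  have hcop : IsCoprime a (b ^ 2) :=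
    IsCoprime.pow_right ⟨a ^ 2, -k, by linear_combination hk⟩
  obtain ⟨j, hj⟩ := hcop.dvd_of_dvd_mul_left (z := k ^ 2 - b)
    ⟨a ^ 5 - 2 * a ^ 2 - m, by linear_combination -(a ^ 3 - 1 + b * k) * hk - hm⟩
  exact ⟨k, j, hk, hj⟩

open Polynomial in
theorem cubicPoly_eq {a b k j : ℤ} (t : ℤ) (ha : a ≠ 0) (hb : b ≠ 0)
    (hk : a ^ 3 - 1 = b * k) (hj : k ^ 2 - b = a * j) :
    cubicPoly a b t = X ^ 3 + C ((j + t * a : ℤ) : ℚ) * X ^ 2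
      + C ((-(a * k) - t * b : ℤ) : ℚ) * X + 1 := by
  have ha' : (a : ℚ) ≠ 0 := by exact_mod_cast ha
  have hb' : (b : ℚ) ≠ 0 := by exact_mod_cast hb
  have hk' : (a : ℚ) ^ 3 - 1 = b * k := by exact_mod_cast hk
  have hj' : (k : ℚ) ^ 2 - b = a * j := by exact_mod_cast hj
  have h1 : (((a : ℚ) ^ 3 - 1) ^ 2 - (b : ℚ) ^ 3) / (a * (b : ℚ) ^ 2) = j := by
    rw [hk', div_eq_iff (by positivity)]
    linear_combination (b : ℚ) ^ 2 * hj'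
  have h2 : -(a : ℚ) * (((a : ℚ) ^ 3 - 1) / b) = -(a * k) := by
    rw [hk', mul_div_cancel_left₀ _ hb']
    ring
  rw [cubicPoly, h1, h2]
  push_cast
  ring_nf

/-- `x` lists the roots of `X³ + P X² + Q X + 1`. -/
structure IsRootTriple (P Q : ℤ) (x : Fin 3 → ℝ) : Prop where
  sum_eq : x 0 + x 1 + x 2 = -P
  pair_eq : x 0 * x 1 + x 0 * x 2 + x 1 * x 2 = Q
  prod_eq : x 0 * x 1 * x 2 = -1

/-- The square root of the discriminant of a triple. -/
def vandermonde (x : Fin 3 → ℝ) : ℝ := (x 0 - x 1) * (x 1 - x 2) * (x 0 - x 2)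

/-! ### Norms and discriminants of elements of the order. -/

namespace IsRootTriple

variable {P Q : ℤ} {x : Fin 3 → ℝ}

theorem factor (hx : IsRootTriple P Q x) (y : ℝ) :
    y ^ 3 + P * y ^ 2 + Q * y + 1 = (y - x 0) * (y - x 1) * (y - x 2) := by
  linear_combination y ^ 2 * hx.sum_eq - y * hx.pair_eq + hx.prod_eq

theorem eval_eq_zero (hx : IsRootTriple P Q x) (i : Fin 3) :
    x i ^ 3 + P * x i ^ 2 + Q * x i + 1 = 0 := by
  rw [hx.factor]
  fin_cases i <;> simp

theorem ne_zero (hx : IsRootTriple P Q x) (i : Fin 3) : x i ≠ 0 := by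
  intro h
  simpa [h] using hx.eval_eq_zero i

/-- The norm of an element of the order is an integer. -/
theorem exists_norm (hx : IsRootTriple P Q x) (c₀ c₁ c₂ : ℤ) :
    ∃ n : ℤ, (c₀ + c₁ * x 0 + c₂ * x 0 ^ 2) * (c₀ + c₁ * x 1 + c₂ * x 1 ^ 2) *
      (c₀ + c₁ * x 2 + c₂ * x 2 ^ 2) = (n : ℝ) := by
  have h1 : (P : ℝ) = -(x 0 + x 1 + x 2) := by linarith [hx.sum_eq]
  have h2 := hx.pair_eq
  refine ⟨c₀ ^ 3 - c₁ ^ 3 + c₂ ^ 3 - c₀ ^ 2 * c₁ * P + c₀ ^ 2 * c₂ * (P ^ 2 - 2 * Q)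
    + c₀ * c₁ ^ 2 * Q + c₀ * c₂ ^ 2 * (Q ^ 2 - 2 * P) + c₁ ^ 2 * c₂ * P - c₁ * c₂ ^ 2 * Q
    + c₀ * c₁ * c₂ * (3 - P * Q), ?_⟩
  push_cast
  rw [h1, ← h2]
  have h3 := hx.prod_eq
  linear_combination (c₁ ^ 3 + c₂ ^ 3 * (x 0 * x 1 * x 2 - 1)
    - 2 * c₀ * c₂ ^ 2 * (x 0 + x 1 + x 2)
    + c₁ ^ 2 * c₂ * (x 0 + x 1 + x 2) + c₁ * c₂ ^ 2 * (x 0 * x 1 + x 0 * x 2 + x 1 * x 2)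
    - 3 * c₀ * c₁ * c₂) * h3

/-- The discriminant of an element is the discriminant of the order times the square of an
integer, which vanishes only for rational integers. -/
theorem exists_vandermonde (hx : IsRootTriple P Q x) (hirr : ∀ i, Irrational (x i))
    (c₀ c₁ c₂ : ℤ) {u : Fin 3 → ℝ} (hu : ∀ i, u i = c₀ + c₁ * x i + c₂ * x i ^ 2)
    (hc : ¬(c₁ = 0 ∧ c₂ = 0)) :
    ∃ n : ℤ, n ≠ 0 ∧ vandermonde u = n * vandermonde x := by
  -- `(u i - u j) / (x i - x j) = c₁ + c₂ (x i + x j) = d - c₂ x k` for the third index `k`, since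
  -- the roots sum to `-P`. The integer sought is thus the product of the three factors `d - c₂ x
  -- k`.
  set d : ℤ := c₁ - c₂ * P with hd
  have e : ((d ^ 3 + d ^ 2 * c₂ * P + d * c₂ ^ 2 * Q + c₂ ^ 3 : ℤ) : ℝ)
      = (d - c₂ * x 0) * (d - c₂ * x 1) * (d - c₂ * x 2) := by
    push_cast
    linear_combination (d ^ 2 * c₂ : ℝ) * hx.sum_eq - (d * c₂ ^ 2 : ℝ) * hx.pair_eq
      + (c₂ ^ 3 : ℝ) * hx.prod_eq
  refine ⟨d ^ 3 + d ^ 2 * c₂ * P + d * c₂ ^ 2 * Q + c₂ ^ 3, ?_, ?_⟩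
  · intro h0
    rw [h0, Int.cast_zero] at e
    have key : ∃ i, (d : ℝ) - c₂ * x i = 0 := by
      rcases mul_eq_zero.mp e.symm with h | h
      · rcases mul_eq_zero.mp h with h | h
        exacts [⟨0, h⟩, ⟨1, h⟩]
      · exact ⟨2, h⟩
    obtain ⟨i, hi⟩ := key
    by_cases h2 : c₂ = 0
    · apply hc
      simp only [h2, Int.cast_zero, zero_mul, sub_zero, Int.cast_eq_zero] at hi
      simp only [h2, zero_mul, sub_zero] at hd
      exact ⟨hd ▸ hi, h2⟩
    · apply hirr i
      refine ⟨(d : ℚ) / c₂, ?_⟩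
      have : (c₂ : ℝ) ≠ 0 := by exact_mod_cast h2
      push_cast
      rw [div_eq_iff this]
      linarith
  · have hP : (d : ℝ) = c₁ + c₂ * (x 0 + x 1 + x 2) := by
      rw [hx.sum_eq, hd]; push_cast; ring
    rw [e, hP, vandermonde, vandermonde, hu, hu, hu]
    ring

end IsRootTriple

/-- Each difference is at most twice the larger entry, which gives `8 |p| |q| |p|`; trading one
`|p|` for `M |r|` brings in the product `1`. -/
theorem abs_vandermonde_le_of_sorted {p q r M : ℝ} (h1 : |q| ≤ |p|) (h2 : |r| ≤ |q|)
    (hM : |p| ≤ M * |r|) (hN : |p| * |q| * |r| = 1) :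
    |(p - q) * (q - r) * (p - r)| ≤ 8 * M := by
  have a1 : |p - q| ≤ 2 * |p| := (abs_sub p q).trans (by linarith)
  have a2 : |q - r| ≤ 2 * |q| := (abs_sub q r).trans (by linarith)
  have a3 : |p - r| ≤ 2 * |p| := (abs_sub p r).trans (by linarith)
  rw [abs_mul, abs_mul]
  calc |p - q| * |q - r| * |p - r| ≤ (2 * |p|) * (2 * |q|) * (2 * |p|) := by gcongr
    _ ≤ (2 * |p|) * (2 * |q|) * (2 * (M * |r|)) := by gcongr
    _ = 8 * M * (|p| * |q| * |r|) := by ring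
    _ = 8 * M := by rw [hN, mul_one]

theorem abs_vandermonde_le {u : Fin 3 → ℝ} {M : ℝ} (hM : ∀ i j, |u i| ≤ M * |u j|)
    (hN : |u 0| * |u 1| * |u 2| = 1) : |vandermonde u| ≤ 8 * M := by
  unfold vandermonde
  rcases le_total |u 0| |u 1| with h01 | h01 <;> rcases le_total |u 1| |u 2| with h12 | h12 <;>
    rcases le_total |u 0| |u 2| with h02 | h02
  · have := abs_vandermonde_le_of_sorted h12 h01 (hM _ _) (by linarith)
    rw [abs_le] at this ⊢; constructor <;> linarith
  · have := abs_vandermonde_le_of_sorted h12 h01 (hM _ _) (by linarith)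
    rw [abs_le] at this ⊢; constructor <;> linarith
  · have := abs_vandermonde_le_of_sorted h12 h02 (hM _ _) (by linarith)
    rw [abs_le] at this ⊢; constructor <;> linarith
  · have := abs_vandermonde_le_of_sorted h01 h02 (hM _ _) (by linarith)
    rw [abs_le] at this ⊢; constructor <;> linarith
  · have := abs_vandermonde_le_of_sorted h02 h01 (hM _ _) (by linarith)
    rw [abs_le] at this ⊢; constructor <;> linarith
  · have := abs_vandermonde_le_of_sorted h02 h12 (hM _ _) (by linarith)
    rw [abs_le] at this ⊢; constructor <;> linarith
  · have := abs_vandermonde_le_of_sorted h01 h12 (hM _ _) (by linarith)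
    rw [abs_le] at this ⊢; constructor <;> linarith
  · have := abs_vandermonde_le_of_sorted h01 h12 (hM _ _) (by linarith)
    rw [abs_le] at this ⊢; constructor <;> linarith

/-- An element of norm `±1` whose conjugates have nearly equal absolute values, compared with the
discriminant of the order, is `±1`. -/
theorem IsRootTriple.abs_eq_one_of_spread_lt {P Q : ℤ} {x : Fin 3 → ℝ} (hx : IsRootTriple P Q x)
    (hirr : ∀ i, Irrational (x i)) {c₀ c₁ c₂ : ℤ} {u : Fin 3 → ℝ}
    (hu : ∀ i, u i = c₀ + c₁ * x i + c₂ * x i ^ 2) (hN : |u 0| * |u 1| * |u 2| = 1)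
    {M : ℝ} (hM : ∀ i j, |u i| ≤ M * |u j|) (hlt : 8 * M < |vandermonde x|) (i : Fin 3) :
    |u i| = 1 := by
  by_cases hc : c₁ = 0 ∧ c₂ = 0
  · have hu' : ∀ i, u i = c₀ := fun i => by rw [hu, hc.1, hc.2]; simp
    rw [hu', hu', hu'] at hN
    rw [hu']
    exact (pow_eq_one_iff_of_nonneg (abs_nonneg _) three_ne_zero).mp (by linarith)
  · exfalso
    obtain ⟨n, hn, hv⟩ := hx.exists_vandermonde hirr c₀ c₁ c₂ hu hc
    have h1 := abs_vandermonde_le hM hN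
    have h2 : (1 : ℝ) ≤ |(n : ℝ)| := by exact_mod_cast Int.one_le_abs hn
    rw [hv, abs_mul] at h1
    nlinarith [abs_nonneg (vandermonde x)]

/-! ### The order `ℤ[g]` and its unit lattice. -/

theorem exists_coeffs_of_mem_adjoin {K : Type*} [Field K] {g : K} {P Q : ℤ}
    (hg : g ^ 3 + P * g ^ 2 + Q * g + 1 = 0) {y : K} (hy : y ∈ Algebra.adjoin ℤ {g}) :
    ∃ c₀ c₁ c₂ : ℤ, y = c₀ + c₁ * g + c₂ * g ^ 2 := by
  induction hy using Algebra.adjoin_induction with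
  | mem y hy =>
    rw [Set.mem_singleton_iff] at hy
    exact ⟨0, 1, 0, by simp [hy]⟩
  | algebraMap r => exact ⟨r, 0, 0, by simp⟩
  | add y z _ _ h1 h2 =>
    obtain ⟨c₀, c₁, c₂, rfl⟩ := h1
    obtain ⟨d₀, d₁, d₂, rfl⟩ := h2
    exact ⟨c₀ + d₀, c₁ + d₁, c₂ + d₂, by push_cast; ring⟩
  | mul y z _ _ h1 h2 =>
    obtain ⟨c₀, c₁, c₂, rfl⟩ := h1
    obtain ⟨d₀, d₁, d₂, rfl⟩ := h2
    refine ⟨c₀ * d₀ - (c₁ * d₂ + c₂ * d₁) + c₂ * d₂ * P,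
      c₀ * d₁ + c₁ * d₀ - (c₁ * d₂ + c₂ * d₁) * Q + c₂ * d₂ * (P * Q - 1),
      c₀ * d₂ + c₁ * d₁ + c₂ * d₀ - (c₁ * d₂ + c₂ * d₁) * P + c₂ * d₂ * (P ^ 2 - Q), ?_⟩
    push_cast
    linear_combination ((c₁ * d₂ + c₂ * d₁) + c₂ * d₂ * (g - P)) * hg

/-- The vector of logarithms of absolute values. -/
noncomputable def logVec (x : Fin 3 → ℝ) : EuclideanSpace ℝ (Fin 3) :=
  WithLp.toLp 2 fun i => Real.log |x i|

@[simp]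
theorem logVec_apply (x : Fin 3 → ℝ) (i : Fin 3) : logVec x i = Real.log |x i| := rfl

theorem log_add_log_add_log {p q r : ℝ} (h : |p| * |q| * |r| = 1) :
    Real.log |p| + Real.log |q| + Real.log |r| = 0 := by
  have hp : |p| ≠ 0 := by intro h0; simp [h0] at h
  have hq : |q| ≠ 0 := by intro h0; simp [h0] at h
  have hr : |r| ≠ 0 := by intro h0; simp [h0] at h
  rw [← Real.log_mul hp hq, ← Real.log_mul (mul_ne_zero hp hq) hr, h, Real.log_one]

/-- Reduction modulo a lattice of rank two in the plane of trace zero vectors. -/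
theorem exists_reduced {v w y : EuclideanSpace ℝ (Fin 3)} (hv : v 0 + v 1 + v 2 = 0)
    (hw : w 0 + w 1 + w 2 = 0) (hy : y 0 + y 1 + y 2 = 0) (hdet : v 0 * w 1 - v 1 * w 0 ≠ 0) :
    ∃ (m n : ℤ) (s r : ℝ), |s| ≤ 1 / 2 ∧ |r| ≤ 1 / 2 ∧
      ∀ i, y i - m * v i - n * w i = s * v i + r * w i := by
  set D := v 0 * w 1 - v 1 * w 0 with hD
  set S := (y 0 * w 1 - y 1 * w 0) / D with hS
  set R := (v 0 * y 1 - v 1 * y 0) / D with hR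
  have h0 : y 0 = S * v 0 + R * w 0 := by
    rw [hS, hR]; field_simp; rw [hD]; ring
  have h1 : y 1 = S * v 1 + R * w 1 := by
    rw [hS, hR]; field_simp; rw [hD]; ring
  have h2 : y 2 = S * v 2 + R * w 2 := by
    linear_combination hy - h0 - h1 - S * hv - R * hw
  refine ⟨round S, round R, S - round S, R - round R, abs_sub_round S, abs_sub_round R, ?_⟩
  intro i
  have hi : y i = S * v i + R * w i := by
    fin_cases i
    exacts [h0, h1, h2]
  rw [hi]; ring

section Order

variable {K : Type*} [Field K] {g : K} {σ : Fin 3 → (K →+* ℝ)} {P Q a b : ℤ} {x : Fin 3 → ℝ}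

theorem unit_exists_coeffs (hg : g ^ 3 + P * g ^ 2 + Q * g + 1 = 0)
    (hσ : ∀ i, σ i g = x i) (u : (Algebra.adjoin ℤ {g})ˣ) :
    ∃ c₀ c₁ c₂ : ℤ, ∀ i, σ i (u : Algebra.adjoin ℤ {g}) = c₀ + c₁ * x i + c₂ * x i ^ 2 := by
  obtain ⟨c₀, c₁, c₂, h⟩ := exists_coeffs_of_mem_adjoin hg (u : Algebra.adjoin ℤ {g}).2
  exact ⟨c₀, c₁, c₂, fun i => by rw [h]; simp [hσ]⟩

theorem abs_norm_unit_eq_one (hg : g ^ 3 + P * g ^ 2 + Q * g + 1 = 0)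
    (hσ : ∀ i, σ i g = x i) (hx : IsRootTriple P Q x) (u : (Algebra.adjoin ℤ {g})ˣ) :
    |σ 0 (u : Algebra.adjoin ℤ {g})| * |σ 1 (u : Algebra.adjoin ℤ {g})| *
      |σ 2 (u : Algebra.adjoin ℤ {g})| = 1 := by
  have key : ∀ u : (Algebra.adjoin ℤ {g})ˣ, ∃ n : ℤ, σ 0 (u : Algebra.adjoin ℤ {g}) *
      σ 1 (u : Algebra.adjoin ℤ {g}) * σ 2 (u : Algebra.adjoin ℤ {g}) = n := by
    intro u
    obtain ⟨c₀, c₁, c₂, h⟩ := unit_exists_coeffs hg hσ u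
    obtain ⟨n, hn⟩ := hx.exists_norm c₀ c₁ c₂
    exact ⟨n, by rw [h, h, h, hn]⟩
  -- The norms of `u` and of its inverse are integers with product `1`.
  obtain ⟨n, hn⟩ := key u
  obtain ⟨m, hm⟩ := key u⁻¹
  have hi : ∀ i, σ i (u : Algebra.adjoin ℤ {g}) *
      σ i ((u⁻¹ : (Algebra.adjoin ℤ {g})ˣ) : Algebra.adjoin ℤ {g}) = 1 := by
    intro i
    rw [← map_mul, ← Subalgebra.coe_mul, Units.mul_inv, Subalgebra.coe_one, map_one]
  have hnm : (n : ℝ) * m = 1 := by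
    rw [← hn, ← hm]
    calc _ = (σ 0 (u : Algebra.adjoin ℤ {g}) *
          σ 0 ((u⁻¹ : (Algebra.adjoin ℤ {g})ˣ) : Algebra.adjoin ℤ {g})) *
        (σ 1 (u : Algebra.adjoin ℤ {g}) *
          σ 1 ((u⁻¹ : (Algebra.adjoin ℤ {g})ˣ) : Algebra.adjoin ℤ {g})) *
        (σ 2 (u : Algebra.adjoin ℤ {g}) *
          σ 2 ((u⁻¹ : (Algebra.adjoin ℤ {g})ˣ) : Algebra.adjoin ℤ {g})) := by ring
      _ = 1 := by rw [hi, hi, hi]; norm_num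
  have hu : IsUnit n := IsUnit.of_mul_eq_one m (by exact_mod_cast hnm)
  rw [← abs_mul, ← abs_mul, hn]
  exact_mod_cast Int.isUnit_iff_abs_eq.mp hu

theorem sum_eq_zero_of_mem_unitLattice (hg : g ^ 3 + P * g ^ 2 + Q * g + 1 = 0)
    (hσ : ∀ i, σ i g = x i) (hx : IsRootTriple P Q x) {y : EuclideanSpace ℝ (Fin 3)}
    (hy : y ∈ unitLattice (Algebra.adjoin ℤ {g}) σ) : y 0 + y 1 + y 2 = 0 := by
  obtain ⟨u, rfl⟩ := hy
  exact log_add_log_add_log (abs_norm_unit_eq_one hg hσ hx u.toMul)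

theorem logVec_mem_unitLattice {c : K} {y : Fin 3 → ℝ} (hc : ∀ i, σ i c = y i)
    {d : K} (hcO : c ∈ Algebra.adjoin ℤ {g}) (hdO : d ∈ Algebra.adjoin ℤ {g}) (hcd : c * d = 1) :
    logVec y ∈ unitLattice (Algebra.adjoin ℤ {g}) σ := by
  refine ⟨Additive.ofMul (⟨⟨c, hcO⟩, ⟨d, hdO⟩, Subtype.ext hcd,
    Subtype.ext ((mul_comm d c).trans hcd)⟩ : (Algebra.adjoin ℤ {g})ˣ), ?_⟩
  ext i
  simp [logEmbedding, hc]

theorem logVec_root_mem_unitLattice (hg : g ^ 3 + P * g ^ 2 + Q * g + 1 = 0)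
    (hσ : ∀ i, σ i g = x i) : logVec x ∈ unitLattice (Algebra.adjoin ℤ {g}) σ := by
  have hgO : g ∈ Algebra.adjoin ℤ {g} := Algebra.self_mem_adjoin_singleton ℤ g
  have hz : ∀ n : ℤ, (n : K) ∈ Algebra.adjoin ℤ {g} := fun n => intCast_mem _ n
  refine logVec_mem_unitLattice (d := -(g ^ 2 + P * g + Q)) hσ hgO
    (neg_mem (add_mem (add_mem (pow_mem hgO 2) (mul_mem (hz P) hgO)) (hz Q))) ?_
  linear_combination -hg

theorem logVec_linear_mem_unitLattice (hg : g ^ 3 + P * g ^ 2 + Q * g + 1 = 0)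
    (hab : b ^ 3 + P * a * b ^ 2 + Q * a ^ 2 * b + a ^ 3 = 1) (hσ : ∀ i, σ i g = x i) :
    logVec (fun i => a * x i - b) ∈ unitLattice (Algebra.adjoin ℤ {g}) σ := by
  have hgO : g ∈ Algebra.adjoin ℤ {g} := Algebra.self_mem_adjoin_singleton ℤ g
  have hz : ∀ n : ℤ, (n : K) ∈ Algebra.adjoin ℤ {g} := fun n => intCast_mem _ n
  have hab' : (b : K) ^ 3 + P * a * b ^ 2 + Q * a ^ 2 * b + a ^ 3 = 1 := by
    exact_mod_cast congrArg (Int.cast : ℤ → K) hab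
  -- The polynomial `y³ + P a y² + Q a² y + a³` is `0` at `y = a g` and `1` at `y = b`, so its
  -- difference quotient at these two points is, up to sign, the inverse of `a g - b`.
  refine logVec_mem_unitLattice (c := a * g - b)
    (d := -((a * g) ^ 2 + a * g * b + (b : K) ^ 2 + P * a * (a * g + b) + Q * a ^ 2))
    (fun i => by simp [hσ]) (sub_mem (mul_mem (hz a) hgO) (hz b)) (neg_mem ?_) ?_
  · have h1 := mul_mem (hz a) hgO
    exact add_mem (add_mem (add_mem (add_mem (pow_mem h1 2) (mul_mem h1 (hz b)))
      (pow_mem (hz b) 2)) (mul_mem (mul_mem (hz P) (hz a)) (add_mem h1 (hz b))))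
      (mul_mem (hz Q) (pow_mem (hz a) 2))
  · linear_combination hab' - (a : K) ^ 3 * hg

/-- If the lattice spanned by the logarithms of `g` and `a g - b` is dense enough compared with the
discriminant, then it is the full unit lattice. -/
theorem unitLattice_eq_closure (hg : g ^ 3 + P * g ^ 2 + Q * g + 1 = 0)
    (hab : b ^ 3 + P * a * b ^ 2 + Q * a ^ 2 * b + a ^ 3 = 1) (hσ : ∀ i, σ i g = x i)
    (hx : IsRootTriple P Q x) (hirr : ∀ i, Irrational (x i))
    {v w : EuclideanSpace ℝ (Fin 3)} (hv : v = logVec x) (hw : w = logVec fun i => a * x i - b)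
    (hdet : v 0 * w 1 - v 1 * w 0 ≠ 0) {m : ℝ}
    (hm : ∀ i j, |v i - v j| + |w i - w j| ≤ 2 * m) (hΔ : 8 * Real.exp m < |vandermonde x|) :
    unitLattice (Algebra.adjoin ℤ {g}) σ = AddSubgroup.closure {v, w} := by
  have hvm : v ∈ unitLattice (Algebra.adjoin ℤ {g}) σ := by
    rw [hv]; exact logVec_root_mem_unitLattice hg hσ
  have hwm : w ∈ unitLattice (Algebra.adjoin ℤ {g}) σ := by
    rw [hw]; exact logVec_linear_mem_unitLattice hg hab hσ
  refine le_antisymm (fun y hy => ?_) ?_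
  · obtain ⟨k, n, s, r, hs, hr, h⟩ := exists_reduced
      (sum_eq_zero_of_mem_unitLattice hg hσ hx hvm) (sum_eq_zero_of_mem_unitLattice hg hσ hx hwm)
      (sum_eq_zero_of_mem_unitLattice hg hσ hx hy) hdet
    have hmem : y - k • v - n • w ∈ unitLattice (Algebra.adjoin ℤ {g}) σ :=
      sub_mem (sub_mem hy (zsmul_mem hvm k)) (zsmul_mem hwm n)
    obtain ⟨u, hu⟩ := hmem
    have hui : ∀ i, Real.log |σ i ((u.toMul : (Algebra.adjoin ℤ {g})ˣ) : Algebra.adjoin ℤ {g})|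
        = s * v i + r * w i := by
      intro i
      rw [← h i]
      have := congrArg (fun z : EuclideanSpace ℝ (Fin 3) => z i) hu
      simpa [logEmbedding] using this
    have hpos : ∀ i, 0 <
        |σ i ((u.toMul : (Algebra.adjoin ℤ {g})ˣ) : Algebra.adjoin ℤ {g})| := by
      intro i; simp
    obtain ⟨c₀, c₁, c₂, hc⟩ := unit_exists_coeffs hg hσ u.toMul
    have hone := hx.abs_eq_one_of_spread_lt hirr hc (abs_norm_unit_eq_one hg hσ hx u.toMul)
      (M := Real.exp m) (fun i j => ?_) hΔ
    · have hzero : y - k • v - n • w = 0 := by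
        rw [← hu]
        ext i
        change Real.log |σ i ((u.toMul : (Algebra.adjoin ℤ {g})ˣ) : Algebra.adjoin ℤ {g})| = 0
        rw [hone i, Real.log_one]
      rw [AddSubgroup.mem_closure_pair]
      exact ⟨k, n, by rw [← sub_eq_zero, ← neg_eq_zero, ← hzero]; abel⟩
    · rw [← Real.exp_log (hpos i), ← Real.exp_log (hpos j), ← Real.exp_add, Real.exp_le_exp,
        hui, hui]
      -- The reduced coordinates are at most `1 / 2`, which halves the spread of the basis; this is
      -- why `hm` carries `2 * m`.
      have h1 : s * (v i - v j) ≤ 1 / 2 * |v i - v j| :=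
        (le_abs_self _).trans (by rw [abs_mul]; gcongr)
      have h2 : r * (w i - w j) ≤ 1 / 2 * |w i - w j| :=
        (le_abs_self _).trans (by rw [abs_mul]; gcongr)
      have := hm i j
      linarith
  · rw [AddSubgroup.closure_le]
    rintro y (rfl | rfl)
    exacts [hvm, hwm]

end Order

theorem planeMap_eq (y : EuclideanSpace ℝ (Fin 3)) :
    planeMap y = -(y 0 : ℂ) - (y 1 : ℂ) * (1 + omega) := rfl

theorem hasShape_closure_pair {v w : EuclideanSpace ℝ (Fin 3)} (hv : v 0 + v 1 + v 2 = 0)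
    (hw : w 0 + w 1 + w 2 = 0) {z : UpperHalfPlane} (hz : (z : ℂ) = planeMap w / planeMap v) :
    HasShape (AddSubgroup.closure {v, w}) (cls z) := by
  have hc : planeMap v ≠ 0 := by
    intro h0
    rw [h0, div_zero] at hz
    have := z.im_pos
    rw [← UpperHalfPlane.coe_im, hz] at this
    simp at this
  refine ⟨fun y hy => ?_, z, planeMap v, hc, ?_, rfl⟩
  · obtain ⟨m, n, rfl⟩ := AddSubgroup.mem_closure_pair.mp hy
    rw [Fin.sum_univ_three]
    simp
    linear_combination (m : ℝ) * hv + n * hw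
  · rw [AddMonoidHom.map_closure, Set.image_pair, hz, mul_div_cancel₀ _ hc]
    rfl

/-- Three approximate locations of the roots: near `0`, near `b / a`, and near `-t a`. -/
structure RootBounds (a b t : ℝ) (x : Fin 3 → ℝ) : Prop where
  zero_le : 2 * (|a| * |x 0|) ≤ |b|
  le_one : |b| ≤ 2 * (|a| * |x 1|)
  one_le : |a| * |x 1| ≤ 2 * |b|
  le_two : |t| * |a| ≤ 2 * |x 2|
  two_le : |x 2| ≤ 2 * (|t| * |a|)

/-! ### Location of the three roots. -/

theorem exists_roots_near {a b t : ℝ} (ha : 1 ≤ |a|) (hab : |a| < |b|)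
    (htb : 1000 * |b| ≤ |t|) (hta : 1000 * |a| ^ 3 ≤ |t|) :
    ∃ κ ∈ Set.Icc (-(1 / 2) : ℝ) (1 / 2), ∃ μ ∈ Set.Icc (1 / 2 : ℝ) 2, κ ≠ μ ∧
      (∀ ν, ν = κ ∨ ν = μ → t * a ^ 2 * b ^ 2 * (ν * (ν - 1)) + (b ^ 3 * (ν ^ 3 - ν ^ 2)
        + (a ^ 3 - 1) ^ 2 * ν ^ 2 - a ^ 3 * (a ^ 3 - 1) * ν + a ^ 3) = 0) := by
  have ht : 0 < |t| := by linarith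
  have ht0 : t ≠ 0 := abs_pos.mp ht
  set N := |t| * (|a| ^ 2 * |b| ^ 2) with hN
  have hb1 : 1 ≤ |b| := by linarith
  have hN1 : 1000 * |b| ^ 3 ≤ N := by
    calc 1000 * |b| ^ 3 = (1000 * |b|) * (1 ^ 2 * |b| ^ 2) := by ring
      _ ≤ |t| * (|a| ^ 2 * |b| ^ 2) := by gcongr
  have hN2 : 1000 * (a ^ 3) ^ 2 ≤ N := by
    calc 1000 * (a ^ 3) ^ 2 = (1000 * |a| ^ 3) * (1 * |a| * |a| ^ 2) := by
          rw [← sq_abs (a ^ 3), abs_pow]; ring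
      _ ≤ |t| * (|a| * |a| * |b| ^ 2) := by gcongr
      _ = N := by rw [hN]; ring
  have hc1 : 1 ≤ |a ^ 3| := by rw [abs_pow]; exact one_le_pow₀ ha
  have hb3 := abs_le.mp (abs_pow b 3).le
  have hc := abs_le.mp (show |a ^ 3| ≤ (a ^ 3) ^ 2 by rw [← sq_abs (a ^ 3)]; nlinarith)
  have hc2 : 1 ≤ (a ^ 3) ^ 2 := by rw [← sq_abs (a ^ 3)]; nlinarith
  let E : ℝ → ℝ := fun ν => b ^ 3 * (ν ^ 3 - ν ^ 2)
        + (a ^ 3 - 1) ^ 2 * ν ^ 2 - a ^ 3 * (a ^ 3 - 1) * ν + a ^ 3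
  -- The equation comes from substituting `ν b / a` into the cubic and multiplying by `a³`. The main
  -- term `ν (ν - 1)` takes the values `3/4`, `-1/4`, `2` at `-1/2`, `1/2`, `2`, and `E` is below `N
  -- / 4` there. The extra factor `t` makes the signs independent of the sign of `t`.
  let F : ℝ → ℝ := fun ν => t * (t * a ^ 2 * b ^ 2 * (ν * (ν - 1)) + E ν)
  have hF : ∀ ν, F ν = |t| * (N * (ν * (ν - 1))) + t * E ν := by
    intro ν
    have h1 : |t| * N = t ^ 2 * a ^ 2 * b ^ 2 := by
      rw [hN, sq_abs, sq_abs, ← mul_assoc, ← sq, sq_abs]; ring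
    linear_combination (-(ν * (ν - 1))) * h1
  have hE : ∀ {ν}, |E ν| < N / 4 → |t * E ν| < |t| * (N / 4) := by
    intro ν h
    rw [abs_mul]
    exact mul_lt_mul_of_pos_left h ht
  have e1 : |E (-(1 / 2))| < N / 4 := by
    rw [abs_lt]; simp only [E]; constructor <;> nlinarith
  have e2 : |E (1 / 2)| < N / 4 := by
    rw [abs_lt]; simp only [E]; constructor <;> nlinarith
  have e3 : |E 2| < N / 4 := by
    rw [abs_lt]; simp only [E]; constructor <;> nlinarith
  have hNt : 0 ≤ |t| * N := by positivity
  have f1 : 0 < F (-(1 / 2)) := by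
    rw [hF]; have := abs_lt.mp (hE e1); linarith
  have f2 : F (1 / 2) < 0 := by
    rw [hF]; have := abs_lt.mp (hE e2); linarith
  have f3 : 0 < F 2 := by
    rw [hF]; have := abs_lt.mp (hE e3); linarith
  have hcont : Continuous F := by fun_prop
  obtain ⟨κ, hκ, hκ0⟩ := intermediate_value_Icc' (by norm_num : (-(1 / 2) : ℝ) ≤ 1 / 2)
    hcont.continuousOn ⟨f2.le, f1.le⟩
  obtain ⟨μ, hμ, hμ0⟩ := intermediate_value_Icc (by norm_num : (1 / 2 : ℝ) ≤ 2)
    hcont.continuousOn ⟨f2.le, f3.le⟩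
  refine ⟨κ, hκ, μ, hμ, ?_, ?_⟩
  · rintro rfl
    have : κ = 1 / 2 := le_antisymm hκ.2 hμ.1
    rw [this] at hκ0
    linarith
  · rintro ν (rfl | rfl)
    exacts [(mul_eq_zero.mp hκ0).resolve_left ht0, (mul_eq_zero.mp hμ0).resolve_left ht0]

theorem exists_isRootTriple {a b t k j : ℤ} (hk : a ^ 3 - 1 = b * k) (hj : k ^ 2 - b = a * j)
    (ha : 1 ≤ |(a : ℝ)|) (hab : |(a : ℝ)| < |(b : ℝ)|)
    (htb : 1000 * |(b : ℝ)| ≤ |(t : ℝ)|) (hta : 1000 * |(a : ℝ)| ^ 3 ≤ |(t : ℝ)|) :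
    ∃ x : Fin 3 → ℝ, IsRootTriple (j + t * a) (-(a * k) - t * b) x ∧ RootBounds a b t x := by
  obtain ⟨κ, hκ, μ, hμ, hne, hroot⟩ := exists_roots_near ha hab htb hta
  have hk' : (a : ℝ) ^ 3 - 1 = b * k := by exact_mod_cast hk
  have hj' : (k : ℝ) ^ 2 - b = a * j := by exact_mod_cast hj
  have ha0 : (a : ℝ) ≠ 0 := abs_pos.mp (by linarith)
  have hb0 : (b : ℝ) ≠ 0 := abs_pos.mp (by linarith)
  set P : ℝ := j + t * a with hP
  set Q : ℝ := -(a * k) - t * b with hQ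
  have heval : ∀ ν, ν = κ ∨ ν = μ →
      (ν * b / a) ^ 3 + P * (ν * b / a) ^ 2 + Q * (ν * b / a) + 1 = 0 := by
    intro ν hν
    have h := hroot ν hν
    field_simp
    rw [hP, hQ]
    linear_combination h - ν ^ 2 * b ^ 2 * hj' + (a ^ 3 * ν - ν ^ 2 * (a ^ 3 - 1 + b * k)) * hk'
  have e0 := heval κ (Or.inl rfl)
  have e1 := heval μ (Or.inr rfl)
  set x₀ := κ * b / a with hx₀
  set x₁ := μ * b / a with hx₁
  have hsub : x₀ - x₁ ≠ 0 := by
    rw [hx₀, hx₁, ← sub_div, ← sub_mul]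
    exact div_ne_zero (mul_ne_zero (sub_ne_zero.mpr hne) hb0) ha0
  -- Dividing out the two known roots leaves the relation which makes `-P - x₀ - x₁` the third root.
  have hquot : x₀ ^ 2 + x₀ * x₁ + x₁ ^ 2 + P * (x₀ + x₁) + Q = 0 := by
    apply mul_left_cancel₀ hsub
    linear_combination e0 - e1
  have hax₀ : (a : ℝ) * x₀ = κ * b := by rw [hx₀]; field_simp
  have hax₁ : (a : ℝ) * x₁ = μ * b := by rw [hx₁]; field_simp
  have n0 : |(a : ℝ)| * |x₀| = |κ| * |(b : ℝ)| := by rw [← abs_mul, hax₀, abs_mul]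
  have n1 : |(a : ℝ)| * |x₁| = μ * |(b : ℝ)| := by
    rw [← abs_mul, hax₁, abs_mul, abs_of_pos (by linarith [hμ.1])]
  have hκ' : |κ| ≤ 1 / 2 := abs_le.mpr hκ
  have hb1 : 0 < |(b : ℝ)| := by linarith
  have h3 : |κ| * |(b : ℝ)| ≤ 1 / 2 * |(b : ℝ)| := by gcongr
  have h4 : μ * |(b : ℝ)| ≤ 2 * |(b : ℝ)| := by gcongr; exact hμ.2
  clear_value x₀ x₁ P Q
  have hk2 : |(k : ℝ)| ≤ 2 * |(a : ℝ)| ^ 2 := by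
    have h1 : |(b : ℝ)| * |(k : ℝ)| ≤ |(a : ℝ)| ^ 3 + 1 := by
      rw [← abs_mul, ← hk', ← abs_pow]
      exact (abs_sub _ _).trans (by simp)
    have h2 : (1 : ℝ) ≤ |(a : ℝ)| ^ 3 := one_le_pow₀ ha
    have h3 : |(a : ℝ)| * |(k : ℝ)| ≤ |(a : ℝ)| * (2 * |(a : ℝ)| ^ 2) := by
      have := mul_le_mul_of_nonneg_right hab.le (abs_nonneg (k : ℝ))
      nlinarith
    exact le_of_mul_le_mul_left h3 (by linarith)
  have hj2 : |(a : ℝ)| * |(j : ℝ)| ≤ 4 * |(a : ℝ)| ^ 4 + |(b : ℝ)| := by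
    rw [← abs_mul, ← hj']
    refine (abs_sub _ _).trans ?_
    rw [abs_pow]
    have := pow_le_pow_left₀ (abs_nonneg (k : ℝ)) hk2 2
    nlinarith
  -- The third root differs from `-t a` by `j + x₀ + x₁` up to sign, which is at most half of `|t
  -- a|`.
  have hx2 : |(a : ℝ)| * |(-P - x₀ - x₁) + t * a| ≤ |(a : ℝ)| * (|(t : ℝ)| * |(a : ℝ)| / 2) := by
    have e : (-P - x₀ - x₁) + t * a = -(j + x₀ + x₁) := by rw [hP]; ring
    rw [e, abs_neg]
    have h1 : |j + x₀ + x₁| ≤ |(j : ℝ)| + |x₀| + |x₁| := abs_add_three _ _ _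
    have h2 : |(a : ℝ)| * |j + x₀ + x₁| ≤ |(a : ℝ)| * (|(j : ℝ)| + |x₀| + |x₁|) := by gcongr
    have h5 : 1000 * |(a : ℝ)| ^ 4 ≤ |(t : ℝ)| * |(a : ℝ)| ^ 2 := by
      calc 1000 * |(a : ℝ)| ^ 4 = (1000 * |(a : ℝ)| ^ 3) * |(a : ℝ)| := by ring
        _ ≤ |(t : ℝ)| * |(a : ℝ)| := by gcongr
        _ ≤ |(t : ℝ)| * |(a : ℝ)| ^ 2 := by
          gcongr; exact le_self_pow₀ ha two_ne_zero
    have h6 : 1000 * |(b : ℝ)| ≤ |(t : ℝ)| * |(a : ℝ)| ^ 2 :=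
      htb.trans (le_mul_of_one_le_right (abs_nonneg _) (one_le_pow₀ ha))
    nlinarith
  have hx2' := le_of_mul_le_mul_left hx2 (by linarith)
  have hx2l : |(t : ℝ)| * |(a : ℝ)| ≤ |(-P - x₀ - x₁) + t * a| + |-P - x₀ - x₁| := by
    rw [← abs_mul]
    calc |(t : ℝ) * a| = |((-P - x₀ - x₁) + t * a) - (-P - x₀ - x₁)| := by congr 1; ring
      _ ≤ _ := abs_sub _ _
  have hx2u : |-P - x₀ - x₁| ≤ |(-P - x₀ - x₁) + t * a| + |(t : ℝ)| * |(a : ℝ)| := by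
    rw [← abs_mul]
    calc |-P - x₀ - x₁| = |((-P - x₀ - x₁) + t * a) - t * a| := by congr 1; ring
      _ ≤ _ := abs_sub _ _
  refine ⟨![x₀, x₁, -P - x₀ - x₁], ⟨?_, ?_, ?_⟩, ⟨?_, ?_, ?_, ?_, ?_⟩⟩ <;>
    simp only [Matrix.cons_val_zero, Matrix.cons_val_one, Matrix.cons_val]
  · rw [hP]; push_cast; ring
  · rw [show ((-(a * k) - t * b : ℤ) : ℝ) = Q by rw [hQ]; push_cast; ring]
    linear_combination -hquot
  · linear_combination e0 - x₀ * hquot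
  · linarith
  · have := mul_le_mul_of_nonneg_right hμ.1 hb1.le
    linarith
  · linarith
  · linarith
  · linarith

theorem IsRootTriple.abs_prod {P Q : ℤ} {x : Fin 3 → ℝ} (hx : IsRootTriple P Q x) :
    |x 0| * |x 1| * |x 2| = 1 := by
  rw [← abs_mul, ← abs_mul, hx.prod_eq, abs_neg, abs_one]

/-- A rational root is `±1`. -/
theorem IsRootTriple.eq_int_of_not_irrational {P Q : ℤ} {x : Fin 3 → ℝ}
    (hx : IsRootTriple P Q x) {i : Fin 3} (h : ¬Irrational (x i)) :
    ∃ n : ℤ, x i = n ∧ |n| = 1 := by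
  obtain ⟨q, hq⟩ := not_not.mp h
  have h0 := hx.eval_eq_zero i
  rw [← hq] at h0
  have hq0 : q ^ 3 + P * q ^ 2 + Q * q + 1 = 0 := by exact_mod_cast h0
  have hint : IsIntegral ℤ q := by
    refine ⟨Polynomial.X ^ 3 + (Polynomial.C P * Polynomial.X ^ 2 + Polynomial.C Q * Polynomial.X
      + 1), Polynomial.monic_X_pow_add (by compute_degree!), ?_⟩
    simp only [Polynomial.eval₂_add, Polynomial.eval₂_mul, Polynomial.eval₂_pow,
      Polynomial.eval₂_X, Polynomial.eval₂_C, Polynomial.eval₂_one]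
    simp only [eq_intCast]
    linear_combination hq0
  obtain ⟨n, hn⟩ := IsIntegrallyClosed.isIntegral_iff.mp hint
  have hn' : q = n := by rw [← hn]; rfl
  refine ⟨n, by rw [← hq, hn']; simp, ?_⟩
  rw [hn'] at hq0
  have hn0 : n ^ 3 + P * n ^ 2 + Q * n + 1 = 0 := by exact_mod_cast hq0
  exact Int.isUnit_iff_abs_eq.mp
    (IsUnit.of_mul_eq_one (-(n ^ 2 + P * n + Q)) (by linear_combination -hn0))

theorem IsRootTriple.abs_prod_linear {P Q a b : ℤ} {x : Fin 3 → ℝ} (hx : IsRootTriple P Q x)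
    (hab : b ^ 3 + P * a * b ^ 2 + Q * a ^ 2 * b + a ^ 3 = 1) :
    |a * x 0 - b| * |a * x 1 - b| * |a * x 2 - b| = 1 := by
  have h : (b : ℝ) ^ 3 + P * a * b ^ 2 + Q * a ^ 2 * b + a ^ 3 = 1 := by exact_mod_cast hab
  have e : (a * x 0 - b) * (a * x 1 - b) * (a * x 2 - b) = -1 := by
    linear_combination -h + (a * b ^ 2 : ℝ) * hx.sum_eq - (a ^ 2 * b : ℝ) * hx.pair_eq
      + (a ^ 3 : ℝ) * hx.prod_eq
  rw [← abs_mul, ← abs_mul, e, abs_neg, abs_one]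

/-! ### Sizes of the roots, the linear forms and the discriminant. -/

section Estimates

variable {P Q a b t : ℤ} {x : Fin 3 → ℝ}

/-- The parameter `t` is large compared with `a` and `b`. -/
structure IsLarge (a b t : ℤ) : Prop where
  one_le : 1 ≤ |(a : ℝ)|
  lt : |(a : ℝ)| < |(b : ℝ)|
  le_b : 1000 * |(b : ℝ)| ≤ |(t : ℝ)|
  le_a : 1000 * |(a : ℝ)| ^ 3 ≤ |(t : ℝ)|

theorem IsLarge.le_t (h : IsLarge a b t) : 1000 ≤ |(t : ℝ)| := by
  linarith [h.one_le, h.lt, h.le_b]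

theorem IsLarge.le_mul (h : IsLarge a b t) : 1000 * |(b : ℝ)| ≤ |(t : ℝ)| * |(a : ℝ)| :=
  h.le_b.trans (le_mul_of_one_le_right (abs_nonneg _) h.one_le)

theorem abs_zero_small (hx : IsRootTriple P Q x) (hB : RootBounds a b t x)
    (hL : IsLarge a b t) : |(t : ℝ)| * |(b : ℝ)| * |x 0| ≤ 4 := by
  have ha : 0 < |(a : ℝ)| := by linarith [hL.one_le]
  have h1 : (|(t : ℝ)| * |(a : ℝ)|) * |(b : ℝ)| ≤ (2 * |x 2|) * (2 * (|(a : ℝ)| * |x 1|)) :=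
    mul_le_mul hB.le_two hB.le_one (abs_nonneg _) (by positivity)
  have h2 : |(t : ℝ)| * |(b : ℝ)| ≤ 4 * (|x 1| * |x 2|) := by
    refine le_of_mul_le_mul_left ?_ ha
    linarith
  calc |(t : ℝ)| * |(b : ℝ)| * |x 0| ≤ 4 * (|x 1| * |x 2|) * |x 0| := by gcongr
    _ = 4 * (|x 0| * |x 1| * |x 2|) := by ring
    _ = 4 := by rw [hx.abs_prod, mul_one]

theorem abs_zero_le (hx : IsRootTriple P Q x) (hB : RootBounds a b t x)
    (hL : IsLarge a b t) : |x 0| ≤ 1 / 250 := by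
  have h := abs_zero_small hx hB hL
  have h1 : 1000 * 1 * |x 0| ≤ |(t : ℝ)| * |(b : ℝ)| * |x 0| := by
    gcongr
    exacts [hL.le_t, by linarith [hL.one_le, hL.lt]]
  linarith

theorem half_lt_abs_one (hB : RootBounds a b t x) (hL : IsLarge a b t) : 1 / 2 < |x 1| := by
  have h1 := hB.le_one
  have h2 := hL.lt
  by_contra! h
  nlinarith [hL.one_le, mul_le_mul_of_nonneg_left h (abs_nonneg (a : ℝ))]

theorem abs_one_le (hB : RootBounds a b t x) (hL : IsLarge a b t) : |x 1| ≤ 2 * |(b : ℝ)| :=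
  (le_mul_of_one_le_left (abs_nonneg _) hL.one_le).trans hB.one_le

theorem abs_two_ge (hB : RootBounds a b t x) (hL : IsLarge a b t) : 500 * |(b : ℝ)| ≤ |x 2| := by
  linarith [hL.le_mul, hB.le_two]

theorem abs_lt_abs (hx : IsRootTriple P Q x) (hB : RootBounds a b t x) (hL : IsLarge a b t) :
    |x 0| < |x 1| ∧ |x 1| < |x 2| := by
  have h0 := abs_zero_le hx hB hL
  have h1 := half_lt_abs_one hB hL
  have h2 := abs_one_le hB hL
  have h3 := abs_two_ge hB hL
  have := hL.one_le
  have := hL.lt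
  constructor <;> linarith

theorem linear_zero_bounds (hB : RootBounds a b t x) :
    |(b : ℝ)| ≤ 2 * |a * x 0 - b| ∧ |a * x 0 - b| ≤ 2 * |(b : ℝ)| := by
  have h0 := hB.zero_le
  rw [← abs_mul] at h0
  have h1 := abs_sub (a * x 0 : ℝ) b
  have h2 := abs_sub_abs_le_abs_sub (b : ℝ) (a * x 0)
  rw [abs_sub_comm] at h2
  have := abs_nonneg (b : ℝ)
  constructor <;> linarith

theorem linear_two_bounds (hB : RootBounds a b t x) (hL : IsLarge a b t) :
    |(t : ℝ)| * |(a : ℝ)| ^ 2 ≤ 4 * |a * x 2 - b| ∧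
      |a * x 2 - b| ≤ 4 * (|(t : ℝ)| * |(a : ℝ)| ^ 2) := by
  have h1 := abs_sub (a * x 2 : ℝ) b
  have h2 := abs_sub_abs_le_abs_sub (a * x 2 : ℝ) b
  rw [abs_mul] at h1 h2
  have h3 := mul_le_mul_of_nonneg_left hB.le_two (abs_nonneg (a : ℝ))
  have h4 := mul_le_mul_of_nonneg_left hB.two_le (abs_nonneg (a : ℝ))
  have h5 : 1000 * |(b : ℝ)| ≤ |(t : ℝ)| * |(a : ℝ)| ^ 2 :=
    hL.le_b.trans (le_mul_of_one_le_right (abs_nonneg _) (one_le_pow₀ hL.one_le))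
  have := abs_nonneg (b : ℝ)
  constructor <;> linarith

/-- The other two factors of the norm, which has absolute value `1`, are at least `1 / 2` and `250`.
-/
theorem abs_linear_one_lt (hx : IsRootTriple P Q x) (hB : RootBounds a b t x)
    (hL : IsLarge a b t) (hab : b ^ 3 + P * a * b ^ 2 + Q * a ^ 2 * b + a ^ 3 = 1) :
    |a * x 1 - b| < 1 := by
  have h := hx.abs_prod_linear hab
  have h1 := (linear_zero_bounds hB).1
  have h2 := (linear_two_bounds hB hL).1
  have hb : 1 ≤ |(b : ℝ)| := by linarith [hL.one_le, hL.lt]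
  have h3 : 1000 ≤ |(t : ℝ)| * |(a : ℝ)| ^ 2 :=
    hL.le_t.trans (le_mul_of_one_le_right (abs_nonneg _) (one_le_pow₀ hL.one_le))
  by_contra! hc
  have h4 : (1 / 2 : ℝ) * 1 * 250 ≤ |a * x 0 - b| * |a * x 1 - b| * |a * x 2 - b| := by
    gcongr
    · linarith
    · linarith
  linarith

/-- A rational root is `±1`. The first root is too small and the last too large; if the middle one
were `n = ±1`, then `a n - b` would be an integer of absolute value below `1`, forcing `|a| = |b|`.
-/
theorem irrational_roots (hx : IsRootTriple P Q x) (hB : RootBounds a b t x)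
    (hL : IsLarge a b t) (hab : b ^ 3 + P * a * b ^ 2 + Q * a ^ 2 * b + a ^ 3 = 1) (i : Fin 3) :
    Irrational (x i) := by
  by_contra h
  obtain ⟨n, hn, hn1⟩ := hx.eq_int_of_not_irrational h
  have habs : |x i| = 1 := by rw [hn]; exact_mod_cast hn1
  have h0 := abs_zero_le hx hB hL
  have h2 := abs_two_ge hB hL
  have ha := hL.one_le
  have hlt := hL.lt
  fin_cases i
  · simp only [Fin.zero_eta] at habs; linarith
  · simp only [Fin.mk_one] at habs hn
    have h1 := abs_linear_one_lt hx hB hL hab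
    rw [hn] at h1
    have h3 : |a * n - b| < 1 := by exact_mod_cast h1
    have h4 : a * n = b := by linarith [Int.abs_lt_one_iff.mp h3]
    rw [← h4, Int.cast_mul, abs_mul, ← hn, habs, mul_one] at hlt
    exact lt_irrefl _ hlt
  · simp only [Fin.reduceFinMk] at habs; linarith

/-- The differences are comparable to `b / a`, `t a` and `t a`; each estimate loses a factor `4`. -/
theorem le_abs_vandermonde (hx : IsRootTriple P Q x) (hB : RootBounds a b t x)
    (hL : IsLarge a b t) :
    |(t : ℝ)| ^ 2 * |(a : ℝ)| * |(b : ℝ)| ≤ 64 * |vandermonde x| := by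
  have ha : 0 < |(a : ℝ)| := by linarith [hL.one_le]
  have hlt := hL.lt
  have h0 := abs_zero_le hx hB hL
  have h1 := half_lt_abs_one hB hL
  have h1' := abs_one_le hB hL
  have h2 := abs_two_ge hB hL
  have d1 : |x 1| ≤ 2 * |x 0 - x 1| := by
    have := abs_sub_abs_le_abs_sub (x 1) (x 0)
    rw [abs_sub_comm] at this
    linarith
  have d2 : |(t : ℝ)| * |(a : ℝ)| ≤ 4 * |x 1 - x 2| := by
    have := abs_sub_abs_le_abs_sub (x 2) (x 1)
    rw [abs_sub_comm] at this
    linarith [hB.le_two, hL.le_mul]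
  have d3 : |(t : ℝ)| * |(a : ℝ)| ≤ 4 * |x 0 - x 2| := by
    have := abs_sub_abs_le_abs_sub (x 2) (x 0)
    rw [abs_sub_comm] at this
    linarith [hB.le_two, hL.le_mul]
  have d4 : |(b : ℝ)| ≤ |(a : ℝ)| * (4 * |x 0 - x 1|) := by
    have := mul_le_mul_of_nonneg_left d1 ha.le
    linarith [hB.le_one]
  rw [vandermonde, abs_mul, abs_mul]
  refine le_of_mul_le_mul_left ?_ ha
  calc |(a : ℝ)| * (|(t : ℝ)| ^ 2 * |(a : ℝ)| * |(b : ℝ)|)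
      = |(b : ℝ)| * (|(t : ℝ)| * |(a : ℝ)|) * (|(t : ℝ)| * |(a : ℝ)|) := by ring
    _ ≤ (|(a : ℝ)| * (4 * |x 0 - x 1|)) * (4 * |x 1 - x 2|) * (4 * |x 0 - x 2|) := by gcongr
    _ = _ := by ring

end Estimates

/-! ### The cubic field and its real embeddings. -/

section Field

open Polynomial IntermediateField

theorem irreducible_of_irrational {P Q : ℤ} {x : Fin 3 → ℝ} (hx : IsRootTriple P Q x)
    (hirr : ∀ i, Irrational (x i)) :
    Irreducible (X ^ 3 + C (P : ℚ) * X ^ 2 + C (Q : ℚ) * X + 1 : ℚ[X]) := by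
  have hd : (X ^ 3 + C (P : ℚ) * X ^ 2 + C (Q : ℚ) * X + 1 : ℚ[X]).natDegree = 3 := by
    compute_degree!
  have h0 : (X ^ 3 + C (P : ℚ) * X ^ 2 + C (Q : ℚ) * X + 1 : ℚ[X]) ≠ 0 := by
    intro h; rw [h] at hd; simp at hd
  rw [irreducible_iff_roots_eq_zero_of_degree_le_three (by rw [hd]; norm_num) hd.le,
    Multiset.eq_zero_iff_forall_notMem]
  intro q hq
  rw [mem_roots h0, IsRoot.def] at hq
  simp only [eval_add, eval_mul, eval_pow, eval_X, eval_C, eval_one] at hq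
  have hq' : (q : ℝ) ^ 3 + P * (q : ℝ) ^ 2 + Q * (q : ℝ) + 1 = 0 := by exact_mod_cast hq
  rw [hx.factor] at hq'
  have key : ∃ i, (q : ℝ) - x i = 0 := by
    rcases mul_eq_zero.mp hq' with h | h
    · rcases mul_eq_zero.mp h with h | h
      exacts [⟨0, h⟩, ⟨1, h⟩]
    · exact ⟨2, h⟩
  obtain ⟨i, hi⟩ := key
  exact hirr i ⟨q, by linarith⟩

theorem exists_embeddings {P Q : ℤ} {x : Fin 3 → ℝ} (hx : IsRootTriple P Q x)
    (hirr : ∀ i, Irrational (x i)) {θ : ℂ}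
    (hθ : aeval θ (X ^ 3 + C (P : ℚ) * X ^ 2 + C (Q : ℚ) * X + 1 : ℚ[X]) = 0) :
    ∃ σ : Fin 3 → (ℚ⟮θ⟯ →+* ℝ), ∀ i, σ i (AdjoinSimple.gen ℚ θ) = x i := by
  have hmon : (X ^ 3 + C (P : ℚ) * X ^ 2 + C (Q : ℚ) * X + 1 : ℚ[X]).Monic := by
    monicity!
  have hmin := minpoly.eq_of_irreducible_of_monic (irreducible_of_irrational hx hirr) hθ hmon
  have hint : IsIntegral ℚ θ := ⟨_, hmon, hθ⟩
  have hmem : ∀ i, x i ∈ (minpoly ℚ θ).aroots ℝ := by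
    intro i
    rw [← hmin, mem_aroots]
    exact ⟨hmon.ne_zero, by simpa using hx.eval_eq_zero i⟩
  refine ⟨fun i => ((algHomAdjoinIntegralEquiv ℚ hint).symm ⟨x i, hmem i⟩).toRingHom,
    fun i => ?_⟩
  exact algHomAdjoinIntegralEquiv_symm_apply_gen ℚ hint ⟨x i, hmem i⟩

theorem gen_eval {P Q : ℤ} {θ : ℂ}
    (hθ : aeval θ (X ^ 3 + C (P : ℚ) * X ^ 2 + C (Q : ℚ) * X + 1 : ℚ[X]) = 0) :
    AdjoinSimple.gen ℚ θ ^ 3 + P * AdjoinSimple.gen ℚ θ ^ 2 + Q * AdjoinSimple.gen ℚ θ + 1 = 0 := by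
  apply Subtype.ext
  simpa using hθ

/-- Distinct absolute values leave a single admissible numbering, so the embeddings in
`HasUnitShape` are forced and the shape is unique. -/
theorem eq_roots_of_strictMono {P Q : ℤ} {x : Fin 3 → ℝ} (hx : IsRootTriple P Q x)
    (h01 : |x 0| < |x 1|) (h12 : |x 1| < |x 2|) {K : Type*} [Field K] {g : K}
    (hg : g ^ 3 + P * g ^ 2 + Q * g + 1 = 0) {σ : Fin 3 → (K →+* ℝ)}
    (hσ : StrictMono fun i => |σ i g|) (i : Fin 3) : σ i g = x i := by
  have key : ∀ i, σ i g = x 0 ∨ σ i g = x 1 ∨ σ i g = x 2 := by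
    intro i
    have h := congrArg (σ i) hg
    simp only [map_add, map_mul, map_pow, map_intCast, map_one, map_zero] at h
    rw [hx.factor] at h
    rcases mul_eq_zero.mp h with h | h
    · rcases mul_eq_zero.mp h with h | h
      exacts [Or.inl (sub_eq_zero.mp h), Or.inr (Or.inl (sub_eq_zero.mp h))]
    · exact Or.inr (Or.inr (sub_eq_zero.mp h))
  have s01 : |σ 0 g| < |σ 1 g| := hσ (by decide)
  have s12 : |σ 1 g| < |σ 2 g| := hσ (by decide)
  have main : σ 0 g = x 0 ∧ σ 1 g = x 1 ∧ σ 2 g = x 2 := by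
    rcases key 0 with h0 | h0 | h0 <;> rcases key 1 with h1 | h1 | h1 <;>
      rcases key 2 with h2 | h2 | h2 <;> rw [h0, h1] at s01 <;> rw [h1, h2] at s12 <;>
      first
        | exact ⟨h0, h1, h2⟩
        | (exfalso; linarith)
  fin_cases i
  exacts [main.1, main.2.1, main.2.2]

end Field

/-! ### Position of the limit point in the upper half plane. -/

section LimitPoint

theorem omega_re : omega.re = -1 / 2 := by simp [omega]

theorem omega_im : omega.im = Real.sqrt 3 / 2 := by simp [omega]

theorem eisenstein_re (p q : ℝ) : ((p : ℂ) + q * omega).re = p - q / 2 := by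
  simp [omega_re]; ring

theorem eisenstein_im (p q : ℝ) : ((p : ℂ) + q * omega).im = q * (Real.sqrt 3 / 2) := by
  simp [omega_im]

theorem normSq_eisenstein (p q : ℝ) :
    Complex.normSq ((p : ℂ) + q * omega) = p ^ 2 - p * q + q ^ 2 := by
  have h3 : Real.sqrt 3 ^ 2 = 3 := Real.sq_sqrt (by norm_num)
  rw [Complex.normSq_apply, eisenstein_re, eisenstein_im]
  linear_combination (q ^ 2 / 4) * h3

variable {α β : ℝ}

theorem limitPoint_eq (α β : ℝ) : limitPoint α β =
    (((1 + 2 * α : ℝ) : ℂ) + (1 + β + 2 * α : ℝ) * omega) /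
      (((1 + α : ℝ) : ℂ) + (α - β : ℝ) * omega) := by
  rw [limitPoint]; push_cast; rfl

theorem limitPoint_denom_pos (h0 : 0 ≤ α) (h1 : α ≤ β) :
    0 < (1 + α) ^ 2 - (1 + α) * (α - β) + (α - β) ^ 2 := by nlinarith

theorem limitPoint_im (α β : ℝ) : (limitPoint α β).im =
    Real.sqrt 3 / 2 * (1 + 2 * α + 2 * β + 3 * α * β) /
      ((1 + α) ^ 2 - (1 + α) * (α - β) + (α - β) ^ 2) := by
  rw [limitPoint_eq, Complex.div_im, normSq_eisenstein, eisenstein_re, eisenstein_re,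
    eisenstein_im, eisenstein_im, ← sub_div]
  congr 1
  ring

theorem limitPoint_im_pos (h0 : 0 ≤ α) (h1 : α ≤ β) : 0 < (limitPoint α β).im := by
  rw [limitPoint_im]
  have := h0.trans h1
  exact div_pos (by positivity) (limitPoint_denom_pos h0 h1)

theorem limitPoint_re (α β : ℝ) : (limitPoint α β).re =
    ((1 + 2 * α) * (1 + α) + (1 + β + 2 * α) * (α - β)
      - ((1 + 2 * α) * (α - β) + (1 + β + 2 * α) * (1 + α)) / 2) /
      ((1 + α) ^ 2 - (1 + α) * (α - β) + (α - β) ^ 2) := by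
  have h3 : Real.sqrt 3 ^ 2 = 3 := Real.sq_sqrt (by norm_num)
  rw [limitPoint_eq, Complex.div_re, normSq_eisenstein, eisenstein_re, eisenstein_re,
    eisenstein_im, eisenstein_im, ← add_div]
  congr 1
  linear_combination ((1 + β + 2 * α) * (α - β) / 4) * h3

theorem normSq_limitPoint (α β : ℝ) : Complex.normSq (limitPoint α β) =
    ((1 + 2 * α) ^ 2 - (1 + 2 * α) * (1 + β + 2 * α) + (1 + β + 2 * α) ^ 2) /
      ((1 + α) ^ 2 - (1 + α) * (α - β) + (α - β) ^ 2) := by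
  rw [limitPoint_eq, map_div₀, normSq_eisenstein, normSq_eisenstein]

theorem norm_limitPoint_zero (hβ : 0 ≤ β) : ‖limitPoint 0 β‖ = 1 := by
  rw [← sq_eq_sq₀ (norm_nonneg _) zero_le_one, ← Complex.normSq_eq_norm_sq, normSq_limitPoint,
    one_pow, div_eq_one_iff_eq (limitPoint_denom_pos le_rfl hβ).ne']
  ring

theorem limitPoint_self_re (hα : 0 ≤ α) : (limitPoint α α).re = 1 / 2 := by
  rw [limitPoint_re, div_eq_iff (limitPoint_denom_pos hα le_rfl).ne']
  ring

theorem limitPoint_zero_zero : limitPoint 0 0 = 1 + omega := by simp [limitPoint]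

theorem closure_one_add_omega :
    AddSubgroup.closure {1, 1 + omega} = AddSubgroup.closure {1, omega} := by
  apply le_antisymm <;> rw [AddSubgroup.closure_le] <;> rintro y (rfl | rfl)
  · exact AddSubgroup.subset_closure (by simp)
  · exact AddSubgroup.mem_closure_pair.mpr ⟨1, 1, by simp⟩
  · exact AddSubgroup.subset_closure (by simp)
  · exact AddSubgroup.mem_closure_pair.mpr ⟨-1, 1, by simp⟩

/-- With `D` the denominator in `normSq_limitPoint`, `|z|² - 1 = 3 α (1 + α + β) / D`. -/
theorem one_lt_normSq_limitPoint (h0 : 0 < α) (h1 : α ≤ β) :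
    1 < Complex.normSq (limitPoint α β) := by
  rw [normSq_limitPoint, one_lt_div (limitPoint_denom_pos h0.le h1)]
  nlinarith [mul_pos h0 (h0.trans_le h1), sq_nonneg α]

/-- With the same `D`, `1 / 2 - Re z = 3 (β - α) (1 + α + β) / (2 D)`. This is positive for `α < β`,
and less than `1` because `β` is small. -/
theorem abs_limitPoint_re_lt (h0 : 0 ≤ α) (h1 : α < β) (h2 : β < 1 / 10) :
    |(limitPoint α β).re| < 1 / 2 := by
  have hD := limitPoint_denom_pos h0 h1.le
  rw [limitPoint_re, abs_lt, lt_div_iff₀ hD, div_lt_iff₀ hD]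
  constructor <;> nlinarith [mul_nonneg h0 (sub_nonneg.mpr h1.le)]

end LimitPoint

theorem abs_log_sub_log_le {X Y : ℝ} (hY : 0 < Y) (h1 : Y ≤ 64 * X) (h2 : X ≤ 64 * Y) :
    |Real.log X - Real.log Y| ≤ Real.log 64 := by
  have hX : 0 < X := by linarith
  have a1 := Real.log_le_log hY h1
  have a2 := Real.log_le_log hX h2
  rw [Real.log_mul (by norm_num) hX.ne'] at a1
  rw [Real.log_mul (by norm_num) hY.ne'] at a2
  rw [abs_le]
  constructor <;> linarith

/-- Bounded errors in the logarithms disappear after division by `T`, so the roots matter only up to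
constant factors. -/
theorem tendsto_div_of_abs_sub_le {ι : Type*} {l : Filter ι} {T f c : ι → ℝ} {C γ : ℝ}
    (hT : Tendsto T l atTop) (h : ∀ᶠ t in l, |f t - c t| ≤ C)
    (hc : Tendsto (fun t => c t / T t) l (𝓝 γ)) : Tendsto (fun t => f t / T t) l (𝓝 γ) := by
  have h0 : Tendsto (fun t => (f t - c t) / T t) l (𝓝 0) := by
    refine squeeze_zero_norm' ?_ (hT.const_div_atTop C)
    filter_upwards [h, hT.eventually_gt_atTop 0] with t ht hTt
    rw [norm_div, Real.norm_eq_abs, Real.norm_eq_abs, abs_of_pos hTt]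
    gcongr
  refine (show Tendsto _ l (𝓝 (γ + 0)) from hc.add h0).congr (fun t => ?_) |>.trans (by simp)
  ring

/-! ### Logarithmic form of the estimates. -/

section LogEstimates

variable {P Q a b t : ℤ} {x : Fin 3 → ℝ}

theorem log_one_close (hB : RootBounds a b t x) (hL : IsLarge a b t) :
    |Real.log |x 1| - (Real.log |(b : ℝ)| - Real.log |(a : ℝ)|)| ≤ Real.log 64 := by
  have ha : 0 < |(a : ℝ)| := by linarith [hL.one_le]
  have hb : 0 < |(b : ℝ)| := by linarith [hL.lt]
  rw [← Real.log_div hb.ne' ha.ne']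
  refine abs_log_sub_log_le (div_pos hb ha) ?_ ?_
  · rw [div_le_iff₀ ha]
    nlinarith [hB.le_one, abs_nonneg (x 1)]
  · rw [← mul_div_assoc, le_div_iff₀ ha]
    linarith [hB.one_le]

theorem log_two_close (hB : RootBounds a b t x) (hL : IsLarge a b t) :
    |Real.log |x 2| - (Real.log |(t : ℝ)| + Real.log |(a : ℝ)|)| ≤ Real.log 64 := by
  have ha : 0 < |(a : ℝ)| := by linarith [hL.one_le]
  have ht : 0 < |(t : ℝ)| := by linarith [hL.le_t]
  have h := mul_pos ht ha
  rw [← Real.log_mul ht.ne' ha.ne']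
  exact abs_log_sub_log_le h (by linarith [hB.le_two]) (by linarith [hB.two_le])

theorem log_linear_zero_close (hB : RootBounds a b t x) (hL : IsLarge a b t) :
    |Real.log |a * x 0 - b| - Real.log (|(b : ℝ)|)| ≤ Real.log 64 := by
  have hb : 0 < |(b : ℝ)| := by linarith [hL.lt, hL.one_le]
  obtain ⟨h1, h2⟩ := linear_zero_bounds hB
  exact abs_log_sub_log_le hb (by linarith) (by linarith)

theorem log_linear_two_close (hB : RootBounds a b t x) (hL : IsLarge a b t) :
    |Real.log |a * x 2 - b| - (Real.log |(t : ℝ)| + 2 * Real.log |(a : ℝ)|)| ≤ Real.log 64 := by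
  have ha : 0 < |(a : ℝ)| := by linarith [hL.one_le]
  have ht : 0 < |(t : ℝ)| := by linarith [hL.le_t]
  obtain ⟨h1, h2⟩ := linear_two_bounds hB hL
  have h := mul_pos ht (pow_pos ha 2)
  rw [show 2 * Real.log |(a : ℝ)| = Real.log (|(a : ℝ)| ^ 2) by rw [Real.log_pow]; norm_num,
    ← Real.log_mul ht.ne' (pow_pos ha 2).ne']
  exact abs_log_sub_log_le h (by linarith) (by linarith)

/-- The constant `1024` exceeds `8 * 64`, which makes the inequality strict. -/
theorem exp_lt_vandermonde (hx : IsRootTriple P Q x) (hB : RootBounds a b t x)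
    (hL : IsLarge a b t) :
    8 * Real.exp (2 * Real.log |(t : ℝ)| + Real.log |(a : ℝ)| + Real.log |(b : ℝ)|
      - Real.log 1024) < |vandermonde x| := by
  have ha : 0 < |(a : ℝ)| := by linarith [hL.one_le]
  have hb : 0 < |(b : ℝ)| := by linarith [hL.lt, hL.one_le]
  have ht : 0 < |(t : ℝ)| := by linarith [hL.le_t]
  have h := le_abs_vandermonde hx hB hL
  have hp : 0 < |(t : ℝ)| ^ 2 * |(a : ℝ)| * |(b : ℝ)| := by positivity
  rw [show 2 * Real.log |(t : ℝ)| = Real.log (|(t : ℝ)| ^ 2) by rw [Real.log_pow]; norm_num,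
    Real.exp_sub, Real.exp_add, Real.exp_add, Real.exp_log ha, Real.exp_log hb,
    Real.exp_log (pow_pos ht 2), Real.exp_log (by norm_num)]
  linarith

end LogEstimates

/-- The data attached to a large parameter `t`: the roots of the cubic polynomial. -/
def IsRootData (a b t : ℤ) (x : Fin 3 → ℝ) : Prop :=
  RootBounds a b t x ∧ ∃ P Q : ℤ, IsRootTriple P Q x ∧
    b ^ 3 + P * a * b ^ 2 + Q * a ^ 2 * b + a ^ 3 = 1 ∧
    cubicPoly a b t = Polynomial.X ^ 3 + Polynomial.C (P : ℚ) * Polynomial.X ^ 2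
      + Polynomial.C (Q : ℚ) * Polynomial.X + 1

theorem IsLarge.exists_rootData {a b t : ℤ} (hL : IsLarge a b t)
    (h : IsMutuallyCubicRootPair a b) : ∃ x, IsRootData a b t x := by
  obtain ⟨k, j, hk, hj⟩ := h.exists_quotients
  obtain ⟨x, hx, hB⟩ := exists_isRootTriple hk hj hL.one_le hL.lt hL.le_b hL.le_a
  have ha : a ≠ 0 := by
    rintro rfl
    have := hL.one_le
    norm_num at this
  have hb : b ≠ 0 := by
    rintro rfl
    have := hL.lt
    have := hL.one_le
    norm_num at *
    linarith
  refine ⟨x, hB, _, _, hx, ?_, cubicPoly_eq t ha hb hk hj⟩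
  -- The terms in `t` cancel, and with `b k = a³ - 1` the rest is `(a³ - 1)² - a³ (a³ - 1) + a³ =
  -- 1`.
  linear_combination (-b ^ 2) * hj + (1 - b * k) * hk

/-- The unit lattice for root data, under the numerical conditions on its generators. -/
theorem IsRootData.hasUnitShape {a b t : ℤ} {x : Fin 3 → ℝ} (h : IsRootData a b t x)
    (hL : IsLarge a b t) {θ : ℂ} (hθ : Polynomial.aeval θ (cubicPoly a b t) = 0)
    {v w : EuclideanSpace ℝ (Fin 3)} (hv : v = logVec x) (hw : w = logVec fun i => a * x i - b)
    (hdet : v 0 * w 1 - v 1 * w 0 ≠ 0)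
    (hm : ∀ i j, |v i - v j| + |w i - w j| ≤ 2 * (2 * Real.log |(t : ℝ)| + Real.log |(a : ℝ)|
      + Real.log |(b : ℝ)| - Real.log 1024))
    {z : UpperHalfPlane} (hz : (z : ℂ) = planeMap w / planeMap v) :
    HasUnitShape θ (cls z) ∧ ∀ s, HasUnitShape θ s → s = cls z := by
  obtain ⟨hB, P, Q, hx, hab, hpoly⟩ := h
  rw [hpoly] at hθ
  have hirr := irrational_roots hx hB hL hab
  obtain ⟨h01, h12⟩ := abs_lt_abs hx hB hL
  have hg := gen_eval hθ
  have hv0 : v 0 + v 1 + v 2 = 0 := by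
    rw [hv]; exact log_add_log_add_log hx.abs_prod
  have hw0 : w 0 + w 1 + w 2 = 0 := by
    rw [hw]; exact log_add_log_add_log (hx.abs_prod_linear hab)
  have key : ∀ σ : Fin 3 → (IntermediateField.adjoin ℚ {θ} →+* ℝ),
      (∀ i, σ i (IntermediateField.AdjoinSimple.gen ℚ θ) = x i) →
      HasShape (unitLattice (Algebra.adjoin ℤ {IntermediateField.AdjoinSimple.gen ℚ θ}) σ)
        (cls z) := by
    intro σ hσ
    rw [unitLattice_eq_closure hg hab hσ hx hirr hv hw hdet hm (exp_lt_vandermonde hx hB hL)]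
    exact hasShape_closure_pair hv0 hw0 hz
  refine ⟨?_, ?_⟩
  · obtain ⟨σ, hσ⟩ := exists_embeddings hx hirr hθ
    refine ⟨σ, Fin.strictMono_iff_lt_succ.mpr fun i => ?_, key σ hσ⟩
    simp only [hσ]
    fin_cases i
    exacts [h01, h12]
  · rintro s ⟨σ, hmono, hs⟩
    exact hs.unique (key σ (eq_roots_of_strictMono hx h01 h12 hg hmono))

theorem tendsto_log_abs_atTop {l : Filter ℤ} (hl : l ≤ cofinite) :
    Tendsto (fun t : ℤ => Real.log |(t : ℝ)|) l atTop := by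
  refine Real.tendsto_log_atTop.comp ?_
  have h : Tendsto (fun t : ℤ => ‖t‖) cofinite atTop := by
    rw [← cocompact_eq_cofinite]; exact tendsto_norm_cocompact_atTop
  simpa [Int.norm_eq_abs] using h.mono_left hl

/-! ### Limits of the normalised log vectors. -/

section Asymptotics

variable {l : Filter ℤ} {a b : ℤ → ℤ} {α β : ℝ}

theorem eventually_isLarge (hl : l ≤ cofinite) (hlt : ∀ᶠ t in l, 0 < |a t| ∧ |a t| < |b t|)
    (hα : Tendsto (fun t : ℤ => Real.log |(a t : ℝ)| / Real.log |(t : ℝ)|) l (𝓝 α))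
    (hβ : Tendsto (fun t : ℤ => Real.log |(b t : ℝ)| / Real.log |(t : ℝ)|) l (𝓝 β))
    (hα_lt : α < 1 / 3) (hβ_lt : β < 1) : ∀ᶠ t in l, IsLarge (a t) (b t) t := by
  have hT := tendsto_log_abs_atTop hl
  have hc := hT.const_div_atTop (Real.log 1000)
  have e1 := (hβ.add hc).eventually_lt_const (show β + 0 < 1 by linarith)
  have e2 := ((hα.const_mul 3).add hc).eventually_lt_const (show 3 * α + 0 < 1 by linarith)
  filter_upwards [hlt, hT.eventually_gt_atTop 0, e1, e2] with t ht hTt h1 h2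
  have ha : (1 : ℝ) ≤ |(a t : ℝ)| := by exact_mod_cast ht.1
  have hab : |(a t : ℝ)| < |(b t : ℝ)| := by exact_mod_cast ht.2
  have ht0 : 0 < |(t : ℝ)| := by
    rcases (abs_nonneg (t : ℝ)).eq_or_lt with h | h
    · rw [← h] at hTt; simp at hTt
    · exact h
  refine ⟨ha, hab, ?_, ?_⟩
  · rw [← add_div, div_lt_one hTt, ← Real.log_mul (by linarith) (by norm_num)] at h1
    linarith [(Real.log_lt_log_iff (by linarith) ht0).mp h1]
  · have h3 : 3 * Real.log |(a t : ℝ)| = Real.log (|(a t : ℝ)| ^ 3) := by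
      rw [Real.log_pow]; norm_num
    have h4 : 0 < |(a t : ℝ)| ^ 3 := by positivity
    rw [← mul_div_assoc, ← add_div, div_lt_one hTt, h3,
      ← Real.log_mul h4.ne' (by norm_num)] at h2
    linarith [(Real.log_lt_log_iff (by linarith) ht0).mp h2]

theorem exponents_le [l.NeBot] (hl : l ≤ cofinite)
    (hlt : ∀ᶠ t in l, 0 < |a t| ∧ |a t| < |b t|)
    (hα : Tendsto (fun t : ℤ => Real.log |(a t : ℝ)| / Real.log |(t : ℝ)|) l (𝓝 α))
    (hβ : Tendsto (fun t : ℤ => Real.log |(b t : ℝ)| / Real.log |(t : ℝ)|) l (𝓝 β)) :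
    0 ≤ α ∧ α ≤ β := by
  have hT := tendsto_log_abs_atTop hl
  constructor
  · refine ge_of_tendsto hα ?_
    filter_upwards [hlt, hT.eventually_gt_atTop 0] with t ht hTt
    exact div_nonneg (Real.log_nonneg (by exact_mod_cast ht.1)) hTt.le
  · refine le_of_tendsto_of_tendsto hα hβ ?_
    filter_upwards [hlt, hT.eventually_gt_atTop 0] with t ht hTt
    have ha : (0 : ℝ) < |(a t : ℝ)| := by exact_mod_cast ht.1
    have hab : |(a t : ℝ)| < |(b t : ℝ)| := by exact_mod_cast ht.2
    gcongr

variable {x : ℤ → Fin 3 → ℝ}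

theorem tendsto_log_roots (hl : l ≤ cofinite) (hL : ∀ᶠ t in l, IsLarge (a t) (b t) t)
    (hx : ∀ᶠ t in l, IsRootData (a t) (b t) t (x t))
    (hα : Tendsto (fun t : ℤ => Real.log |(a t : ℝ)| / Real.log |(t : ℝ)|) l (𝓝 α))
    (hβ : Tendsto (fun t : ℤ => Real.log |(b t : ℝ)| / Real.log |(t : ℝ)|) l (𝓝 β)) (i : Fin 3) :
    Tendsto (fun t => logVec (x t) i / Real.log |(t : ℝ)|) l
      (𝓝 (![-(1 + β), β - α, 1 + α] i)) := by
  have hT := tendsto_log_abs_atTop hl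
  have hTT : Tendsto (fun t : ℤ => Real.log |(t : ℝ)| / Real.log |(t : ℝ)|) l (𝓝 1) :=
    tendsto_const_nhds.congr' <| by
      filter_upwards [hT.eventually_gt_atTop 0] with t ht using (div_self ht.ne').symm
  have h1 : Tendsto (fun t => logVec (x t) 1 / Real.log |(t : ℝ)|) l (𝓝 (β - α)) := by
    refine tendsto_div_of_abs_sub_le hT
      (by filter_upwards [hL, hx] with t h h' using log_one_close h'.1 h) ?_
    simpa only [sub_div] using hβ.sub hα
  have h2 : Tendsto (fun t => logVec (x t) 2 / Real.log |(t : ℝ)|) l (𝓝 (1 + α)) := by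
    refine tendsto_div_of_abs_sub_le hT
      (by filter_upwards [hL, hx] with t h h' using log_two_close h'.1 h) ?_
    simpa only [add_div] using hTT.add hα
  fin_cases i
  -- The first coordinate follows from the other two, since the coordinates sum to zero.
  · have h := (h1.add h2).neg
    rw [show -(β - α + (1 + α)) = -(1 + β) by ring] at h
    refine h.congr' ?_
    filter_upwards [hx] with t ht
    obtain ⟨-, P, Q, ht, -⟩ := ht
    have := log_add_log_add_log ht.abs_prod
    simp only [logVec_apply, Fin.zero_eta]
    rw [← add_div, ← neg_div]
    congr 1
    linarith
  · exact h1
  · exact h2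

theorem tendsto_log_linear (hl : l ≤ cofinite) (hL : ∀ᶠ t in l, IsLarge (a t) (b t) t)
    (hx : ∀ᶠ t in l, IsRootData (a t) (b t) t (x t))
    (hα : Tendsto (fun t : ℤ => Real.log |(a t : ℝ)| / Real.log |(t : ℝ)|) l (𝓝 α))
    (hβ : Tendsto (fun t : ℤ => Real.log |(b t : ℝ)| / Real.log |(t : ℝ)|) l (𝓝 β)) (i : Fin 3) :
    Tendsto (fun t => logVec (fun i => a t * x t i - b t) i / Real.log |(t : ℝ)|) l
      (𝓝 (![β, -(1 + β + 2 * α), 1 + 2 * α] i)) := by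
  have hT := tendsto_log_abs_atTop hl
  have hTT : Tendsto (fun t : ℤ => Real.log |(t : ℝ)| / Real.log |(t : ℝ)|) l (𝓝 1) :=
    tendsto_const_nhds.congr' <| by
      filter_upwards [hT.eventually_gt_atTop 0] with t ht using (div_self ht.ne').symm
  have h0 : Tendsto (fun t => logVec (fun i => a t * x t i - b t) 0 / Real.log |(t : ℝ)|) l
      (𝓝 β) :=
    tendsto_div_of_abs_sub_le hT
      (by filter_upwards [hL, hx] with t h h' using log_linear_zero_close h'.1 h) hβ
  have h2 : Tendsto (fun t => logVec (fun i => a t * x t i - b t) 2 / Real.log |(t : ℝ)|) l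
      (𝓝 (1 + 2 * α)) := by
    refine tendsto_div_of_abs_sub_le hT
      (by filter_upwards [hL, hx] with t h h' using log_linear_two_close h'.1 h) ?_
    simpa only [add_div, mul_div_assoc] using hTT.add (hα.const_mul 2)
  fin_cases i
  · exact h0
  · have h := (h0.add h2).neg
    rw [show -(β + (1 + 2 * α)) = -(1 + β + 2 * α) by ring] at h
    refine h.congr' ?_
    filter_upwards [hx] with t ht
    obtain ⟨-, P, Q, ht, hab, -⟩ := ht
    have := log_add_log_add_log (ht.abs_prod_linear hab)
    simp only [logVec_apply, Fin.mk_one]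
    rw [← add_div, ← neg_div]
    congr 1
    linarith
  · exact h2

/-- The spread of the two limit vectors is compared with twice the exponent `2 + α + β` of the
discriminant bound. The form `2 * 1 + α + β - 0` matches the limit of the bound in
`eventually_spread_le`. -/
theorem exponent_spread_lt (h0 : 0 ≤ α) (h1 : α ≤ β) (hα_lt : α < 1 / 3) (hβ_lt : β < 1)
    (i j : Fin 3) :
    |![-(1 + β), β - α, 1 + α] i - ![-(1 + β), β - α, 1 + α] j|
      + |![β, -(1 + β + 2 * α), 1 + 2 * α] i - ![β, -(1 + β + 2 * α), 1 + 2 * α] j|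
      < 2 * (2 * 1 + α + β - 0) := by
  have key : ∀ p q r : ℝ, p + q < r → p - q < r → -p + q < r → -p - q < r → |p| + |q| < r := by
    intro p q r _ _ _ _
    rcases abs_cases p with h | h <;> rcases abs_cases q with h' | h' <;> linarith
  apply key <;> fin_cases i <;> fin_cases j <;> simp <;> linarith

end Asymptotics

theorem tendsto_planeMap_div {ι : Type*} {l : Filter ι} {T : ι → ℝ}
    {v : ι → EuclideanSpace ℝ (Fin 3)} {V : Fin 3 → ℝ}
    (hv : ∀ i, Tendsto (fun t => v t i / T t) l (𝓝 (V i))) :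
    Tendsto (fun t => planeMap (v t) / (T t : ℂ)) l
      (𝓝 (-(V 0 : ℂ) - (V 1 : ℂ) * (1 + omega))) := by
  have h0 := (Complex.continuous_ofReal.tendsto _).comp (hv 0)
  have h1 := (Complex.continuous_ofReal.tendsto _).comp (hv 1)
  refine (h0.neg.sub (h1.mul_const (1 + omega))).congr fun t => ?_
  simp only [Function.comp_apply, planeMap_eq, Complex.ofReal_div]
  ring

/-! ### Convergence of the shape parameter. -/

section Main

variable {l : Filter ℤ} {a b : ℤ → ℤ} {α β : ℝ}

theorem tendsto_shape_parameter (hl : l ≤ cofinite) {v w : ℤ → EuclideanSpace ℝ (Fin 3)}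
    (hv : ∀ i, Tendsto (fun t => v t i / Real.log |(t : ℝ)|) l
      (𝓝 (![-(1 + β), β - α, 1 + α] i)))
    (hw : ∀ i, Tendsto (fun t => w t i / Real.log |(t : ℝ)|) l
      (𝓝 (![β, -(1 + β + 2 * α), 1 + 2 * α] i)))
    (h0 : 0 ≤ α) (h1 : α ≤ β) :
    Tendsto (fun t => planeMap (w t) / planeMap (v t)) l (𝓝 (limitPoint α β)) := by
  have hT := tendsto_log_abs_atTop hl
  have hne : ((1 + α : ℝ) : ℂ) + (α - β : ℝ) * omega ≠ 0 := by
    rw [← Complex.normSq_pos, normSq_eisenstein]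
    exact limitPoint_denom_pos h0 h1
  have e1 : (-((![-(1 + β), β - α, 1 + α] 0 : ℝ) : ℂ)
      - ((![-(1 + β), β - α, 1 + α] 1 : ℝ) : ℂ) * (1 + omega))
      = ((1 + α : ℝ) : ℂ) + (α - β : ℝ) * omega := by
    simp; ring
  have e2 : (-((![β, -(1 + β + 2 * α), 1 + 2 * α] 0 : ℝ) : ℂ)
      - ((![β, -(1 + β + 2 * α), 1 + 2 * α] 1 : ℝ) : ℂ) * (1 + omega))
      = ((1 + 2 * α : ℝ) : ℂ) + (1 + β + 2 * α : ℝ) * omega := by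
    simp; ring
  have hv' := tendsto_planeMap_div hv
  have hw' := tendsto_planeMap_div hw
  rw [e1] at hv'
  rw [e2] at hw'
  rw [limitPoint_eq]
  refine (hw'.div hv' hne).congr' ?_
  filter_upwards [hT.eventually_gt_atTop 0] with t ht
  exact div_div_div_cancel_right₀ (by exact_mod_cast ht.ne') _ _

theorem eventually_det_ne_zero {v w : ℤ → EuclideanSpace ℝ (Fin 3)}
    (hv : ∀ i, Tendsto (fun t => v t i / Real.log |(t : ℝ)|) l
      (𝓝 (![-(1 + β), β - α, 1 + α] i)))
    (hw : ∀ i, Tendsto (fun t => w t i / Real.log |(t : ℝ)|) l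
      (𝓝 (![β, -(1 + β + 2 * α), 1 + 2 * α] i)))
    (h0 : 0 ≤ α) (h1 : α ≤ β) :
    ∀ᶠ t in l, v t 0 * w t 1 - v t 1 * w t 0 ≠ 0 := by
  have h := ((hv 0).mul (hw 1)).sub ((hv 1).mul (hw 0))
  -- The limiting determinant is `1 + 2α + 2β + 3αβ`.
  have hpos : (0 : ℝ) < ![-(1 + β), β - α, 1 + α] 0 * ![β, -(1 + β + 2 * α), 1 + 2 * α] 1
      - ![-(1 + β), β - α, 1 + α] 1 * ![β, -(1 + β + 2 * α), 1 + 2 * α] 0 := by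
    simp only [Matrix.cons_val_zero, Matrix.cons_val_one]
    have := h0.trans h1
    have : 0 < 1 + 2 * α + 2 * β + 3 * (α * β) := by positivity
    linarith
  filter_upwards [h.eventually_const_lt hpos] with t ht h'
  have e : v t 0 / Real.log |(t : ℝ)| * (w t 1 / Real.log |(t : ℝ)|)
      - v t 1 / Real.log |(t : ℝ)| * (w t 0 / Real.log |(t : ℝ)|)
      = (v t 0 * w t 1 - v t 1 * w t 0) / (Real.log |(t : ℝ)| * Real.log |(t : ℝ)|) := by ring
  rw [e, h', zero_div] at ht
  exact lt_irrefl _ ht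

theorem eventually_spread_le (hl : l ≤ cofinite) {v w : ℤ → EuclideanSpace ℝ (Fin 3)}
    (hv : ∀ i, Tendsto (fun t => v t i / Real.log |(t : ℝ)|) l
      (𝓝 (![-(1 + β), β - α, 1 + α] i)))
    (hw : ∀ i, Tendsto (fun t => w t i / Real.log |(t : ℝ)|) l
      (𝓝 (![β, -(1 + β + 2 * α), 1 + 2 * α] i)))
    (hα : Tendsto (fun t : ℤ => Real.log |(a t : ℝ)| / Real.log |(t : ℝ)|) l (𝓝 α))
    (hβ : Tendsto (fun t : ℤ => Real.log |(b t : ℝ)| / Real.log |(t : ℝ)|) l (𝓝 β))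
    (h0 : 0 ≤ α) (h1 : α ≤ β) (hα_lt : α < 1 / 3) (hβ_lt : β < 1) :
    ∀ᶠ t in l, ∀ i j, |v t i - v t j| + |w t i - w t j| ≤ 2 * (2 * Real.log |(t : ℝ)|
      + Real.log |(a t : ℝ)| + Real.log |(b t : ℝ)| - Real.log 1024) := by
  have hT := tendsto_log_abs_atTop hl
  have hTT : Tendsto (fun t : ℤ => Real.log |(t : ℝ)| / Real.log |(t : ℝ)|) l (𝓝 1) :=
    tendsto_const_nhds.congr' <| by
      filter_upwards [hT.eventually_gt_atTop 0] with t ht using (div_self ht.ne').symm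
  have hrhs := (((((hTT.const_mul 2).add hα).add hβ).sub
    (hT.const_div_atTop (Real.log 1024))).const_mul 2)
  rw [eventually_all]
  intro i
  rw [eventually_all]
  intro j
  have hlhs := (((hv i).sub (hv j)).abs.add ((hw i).sub (hw j)).abs)
  filter_upwards [hlhs.eventually_lt hrhs (exponent_spread_lt h0 h1 hα_lt hβ_lt i j),
    hT.eventually_gt_atTop 0] with t ht hTt
  rw [← sub_div, ← sub_div, abs_div, abs_div, abs_of_pos hTt, ← add_div, ← mul_div_assoc,
    ← add_div, ← add_div, ← sub_div, ← mul_div_assoc, div_lt_div_iff_of_pos_right hTt] at ht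
  exact ht.le

end Main

end UnitShape

theorem mainTheorem4
    (l : Filter ℤ) [l.NeBot] (hl : l ≤ cofinite)
    (a b : ℤ → ℤ)
    (hab : ∀ᶠ t in l, UnitShape.IsMutuallyCubicRootPair (a t) (b t))
    (hlt : ∀ᶠ t in l, 0 < |a t| ∧ |a t| < |b t|)
    (α β : ℝ)
    (hα : Tendsto (fun t : ℤ => Real.log |(a t : ℝ)| / Real.log |(t : ℝ)|) l (𝓝 α))
    (hβ : Tendsto (fun t : ℤ => Real.log |(b t : ℝ)| / Real.log |(t : ℝ)|) l (𝓝 β))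
    (hα_lt : α < 1 / 3) (hβ_lt : β < 1)
    (θ : ℤ → ℂ)
    (hθ : ∀ᶠ t in l, Polynomial.aeval (θ t) (UnitShape.cubicPoly (a t) (b t) t) = 0) :
    ∃ z : UpperHalfPlane,
      (z : ℂ) = UnitShape.limitPoint α β ∧
      (∀ᶠ t in l, ∃ s, UnitShape.HasUnitShape (θ t) s) ∧
      (∀ s : ℤ → UnitShape.ModularSurface,
        (∀ᶠ t in l, UnitShape.HasUnitShape (θ t) (s t)) →
          Tendsto s l (𝓝 (UnitShape.cls z))) ∧
      (α = 0 → β = 0 → (z : ℂ) = 1 + UnitShape.omega ∧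
        AddSubgroup.closure {1, (z : ℂ)} = AddSubgroup.closure {1, UnitShape.omega}) ∧
      (α = 0 → ‖(z : ℂ)‖ = 1) ∧
      (α = β → z.re = 1 / 2) ∧
      (0 < α → α < β → β < 1 / 10 → z ∈ interior ModularGroup.fd) := by
  open UnitShape in
  obtain ⟨h0, h1⟩ := exponents_le hl hlt hα hβ
  have hL := eventually_isLarge hl hlt hα hβ hα_lt hβ_lt
  obtain ⟨x, hx⟩ : ∃ x : ℤ → Fin 3 → ℝ, ∀ᶠ t in l, IsRootData (a t) (b t) t (x t) := by
    apply Eventually.choice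
    filter_upwards [hL, hab] with t ht h using ht.exists_rootData h
  have hv := tendsto_log_roots hl hL hx hα hβ
  have hw := tendsto_log_linear hl hL hx hα hβ
  have hlim := tendsto_shape_parameter hl hv hw h0 h1
  have hpos := limitPoint_im_pos h0 h1
  let z : UpperHalfPlane := ⟨limitPoint α β, hpos⟩
  have hzc : (z : ℂ) = limitPoint α β := rfl
  -- The limit has positive imaginary part, so the quotients eventually lie in the upper half plane;
  -- values of `Z` elsewhere are arbitrary.
  have him := ((Complex.continuous_im.tendsto _).comp hlim).eventually_const_lt hpos
  obtain ⟨Z, hZ⟩ : ∃ Z : ℤ → UpperHalfPlane, ∀ᶠ t in l, (Z t : ℂ) =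
      planeMap (logVec fun i => a t * x t i - b t) / planeMap (logVec (x t)) := by
    apply Eventually.choice (r := fun t (y : UpperHalfPlane) => (y : ℂ) =
      planeMap (logVec fun i => a t * x t i - b t) / planeMap (logVec (x t)))
    filter_upwards [him] with t ht using ⟨⟨_, ht⟩, rfl⟩
  have hZlim : Tendsto Z l (𝓝 z) := by
    rw [UpperHalfPlane.isEmbedding_coe.tendsto_nhds_iff]
    refine hlim.congr' ?_
    filter_upwards [hZ] with t ht using ht.symm
  have hmain : ∀ᶠ t in l, HasUnitShape (θ t) (cls (Z t)) ∧
      ∀ s, HasUnitShape (θ t) s → s = cls (Z t) := by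
    filter_upwards [hL, hx, hθ, hZ, eventually_det_ne_zero hv hw h0 h1,
      eventually_spread_le hl hv hw hα hβ h0 h1 hα_lt hβ_lt] with t a1 a2 a3 a4 a5 a6
    exact a2.hasUnitShape a1 a3 rfl rfl a5 a6 a4
  refine ⟨z, hzc, ?_, ?_, ?_, ?_, ?_, ?_⟩
  · filter_upwards [hmain] with t ht using ⟨_, ht.1⟩
  · intro s hs
    have hcls : Tendsto (fun t => cls (Z t)) l (𝓝 (cls z)) :=
      (continuous_quotient_mk'.tendsto z).comp hZlim
    -- Uniqueness identifies any choice of shapes with `cls (Z t)` eventually.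
    refine hcls.congr' ?_
    filter_upwards [hmain, hs] with t ht hst using (ht.2 _ hst).symm
  · rintro rfl rfl
    rw [hzc, limitPoint_zero_zero]
    exact ⟨rfl, closure_one_add_omega⟩
  · rintro rfl
    rw [hzc]
    exact norm_limitPoint_zero h1
  · rintro rfl
    exact limitPoint_self_re h0
  · intro hα0 hαβ hβ10
    rw [← ModularGroup.fdo_eq_interior_fd]
    exact ⟨one_lt_normSq_limitPoint hα0 h1, abs_limitPoint_re_lt h0 hαβ hβ10⟩
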